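/- Let $1\le d\le 3$, $k\ge 1$ and $\sigma>0$. There is a constant $\alpha_0>0$, depending only on $d,k,\sigma$, such that the following holds. Let $\mathcal T$ be a finite conforming triangulation of a domain $\Omega\subset\mathbb R^d$ into open simplices $K$, with cell sizes $h_K>0$, regular with constant $\sigma$: $\sigma^{-1}\operatorname{diam}K\le h_K\le\sigma\operatorname{diam}K$, each closed cell $\overline K$ contains a closed ball of radius $\sigma^{-1}\operatorname{diam}K$, and $h_K\le\sigma h_{K'}$ whenever $K,K'$ share a facet. In integrals over $\partial K$, $n$ is the outward unit normal of $K$ and $h_K$ denotes on each facet the average of the sizes of the adjacent cells. Let $\Gamma_D\cup\Gamma_N=\partial\Omega$ be a partition of $\partial\Omega$ into exterior facets, and let $\bar k,m,\bar m\ge 0$. Let $V_h$ ($Q_h$) be the vector (scalar) functions that are polynomials of degree $\le k$ ($\le m$) on each cell, with no continuity between cells; let $\bar V_h$ ($\bar Q_h$) be the vector (scalar) functions on the union of the facets that are polynomials of degree $\le\bar k$ ($\le\bar m$) on each facet, those in $\bar V_h$ vanishing on $\Gamma_D$. Optionally, $\bar V_h$ and $\bar Q_h$ are replaced by their subspaces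 of functions continuous on the union of all facets. Let $\chi\in[0,1]$, $\nu\ge 0$, $\beta\ge 0$, $\alpha>0$. For $U=(u,\bar u,p,\bar p)$ put $[\nabla u]_{ij}=\partial u_i/\partial x_j$, $\nabla^s u=\tfrac12(\nabla u+\nabla u^T)$, $[a\otimes b]_{ij}=a_ib_j$ and $$\hat u=u-\tfrac{\beta h_K}{\nu+1}(\bar p-p)n,\qquad \sigma_d=pI-2\nu\nabla^su,\qquad \hat\sigma_d=\bar pI-2\nu\nabla^su-\tfrac{\alpha}{h_K}2\nu(\bar u-u)\otimes n .$$ Fully discrete problem. Given $\theta\in[0,1]$, $\delta t>0$, $f_{n+\theta}\in L^2(\Omega)^d$, $h_{n+\theta}\in L^2(\Gamma_N)^d$ and $U_n\in V_h\times\bar V_h\times Q_h\times\bar Q_h$, write $y_{n+\theta}=(1-\theta)y_n+\theta y_{n+1}$, and let $\lambda=1$ where $\hat u_n\cdot n<0$, $\lambda=0$ elsewhere. $U_{n+1}\in V_h\times\bar V_h\times Q_h\times\bar Q_h$ solves the problem at time $t_{n+1}$ if for all $(v,\bar v,q,\bar q)\in V_h\times\bar V_h\times Q_h\times\bar Q_h$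 one has $F_m+\bar F_m+F_c+\bar F_c=0$, where $$\begin{aligned} F_m={}&\int_\Omega\tfrac{u_{n+1}-u_n}{\delta t}\cdot v\,dx-\chi\sum_K\int_K(u_{n+\theta}\otimes u_n):\nabla v\,dx+(1-\chi)\sum_K\int_K(\nabla u_{n+\theta}\,u_n)\cdot v\,dx\\ &+\chi\sum_K\int_{\partial K}(\hat u_n\cdot n)\,u_{n+\theta}\cdot v\,ds+\sum_K\int_{\partial K}\lambda(\hat u_n\cdot n)(\bar u_{n+\theta}-u_{n+\theta})\cdot v\,ds-\sum_K\int_K\sigma_{d,n+\theta}:\nabla v\,dx\\ &+\sum_K\int_{\partial K}\hat\sigma_{d,n+\theta}n\cdot v\,ds+\sum_K\int_{\partial K}2\nu(\bar u_{n+\theta}-u_{n+\theta})\cdot\nabla^sv\,n\,ds-\int_\Omega f_{n+\theta}\cdot v\,dx,\\ \bar F_m={}&\chi\sum_K\int_{\partial K}(\hat u_n\cdot n)\,u_{n+\theta}\cdot\bar v\,ds-(1-\chi)\sum_K\int_{\partial K}(\hat u_n\cdot n)(\bar u_{n+\theta}-u_{n+\theta})\cdot\bar v\,ds\\ &+\sum_K\int_{\partial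 K}\lambda(\hat u_n\cdot n)(\bar u_{n+\theta}-u_{n+\theta})\cdot\bar v\,ds+\sum_K\int_{\partial K}\hat\sigma_{d,n+\theta}n\cdot\bar v\,ds\\ &-\int_{\Gamma_N}(\chi-\lambda)(\bar u_n\cdot n)\,\bar u_{n+\theta}\cdot\bar v\,ds-\int_{\Gamma_N}h_{n+\theta}\cdot\bar v\,ds,\\ F_c={}&\sum_K\int_Ku_{n+1}\cdot\nabla q\,dx-\sum_K\int_{\partial K}\hat u_{n+1}\cdot n\,q\,ds,\\ \bar F_c={}&\sum_K\int_{\partial K}\hat u_{n+1}\cdot n\,\bar q\,ds-\int_{\partial\Omega}\bar u_{n+1}\cdot n\,\bar q\,ds . \end{aligned}$$ Proposition. Let $\chi=\tfrac12$, $\Gamma_D=\partial\Omega$ and $\alpha\ge\alpha_0$. Let $U_n$ solve the problem at time $t_n$ (from some $U_{n-1}$, with any admissible $\theta$, time increment and forcing term), and let $U_{n+1}$ solve the problem at time $t_{n+1}$ from $U_n$ with $f_{n+\theta}=0$ and $\theta\ge\tfrac12$. Then $$\int_\Omega|u_{n+1}|^2\,dx\le\int_\Omega|u_n|^2\,dx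 .$$ -/

import Mathlib

open MeasureTheory
open scoped Classical

noncomputable section

namespace HybridNS

/-- Euclidean space `ℝ^d`. -/
abbrev Pt (d : ℕ) : Type := EuclideanSpace ℝ (Fin d)

/-! ### Triangulations -/

/-- A finite conforming simplicial triangulation in `ℝ^d`. A cell is given by its set of `d + 1`
affinely independent vertices, and two closed cells meet exactly in the (possibly empty) simplex
spanned by their common vertices. -/
structure Mesh (d : ℕ) where
  cells : Finset (Finset (Pt d))
  card_cell : ∀ K ∈ cells, K.card = d + 1
  indep : ∀ K ∈ cells, AffineIndependent ℝ (fun a : K => (a : Pt d))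
  conforming : ∀ K ∈ cells, ∀ L ∈ cells,
    convexHull ℝ (K : Set (Pt d)) ∩ convexHull ℝ (L : Set (Pt d))
      = convexHull ℝ ((K ∩ L : Finset (Pt d)) : Set (Pt d))

/-- The closed simplex spanned by a finite set of vertices (a cell or a facet). -/
def closedSimplex {d : ℕ} (A : Finset (Pt d)) : Set (Pt d) := convexHull ℝ (A : Set (Pt d))

/-- The open cell with vertex set `K`. -/
def openCell {d : ℕ} (K : Finset (Pt d)) : Set (Pt d) := interior (closedSimplex K)

/-- The component, orthogonal to the facet `F`, of the vector from `a` to the barycentre of `F`. -/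
def awayFrom {d : ℕ} (F : Finset (Pt d)) (a : Pt d) : Pt d :=
  (vectorSpan ℝ (F : Set (Pt d)))ᗮ.starProjection ((F.card : ℝ)⁻¹ • (∑ b ∈ F, b) - a)

/-- The outward unit normal of the cell `K` on the facet `K.erase a` opposite to the vertex `a`. -/
def outwardNormal {d : ℕ} (K : Finset (Pt d)) (a : Pt d) : Pt d :=
  ‖awayFrom (K.erase a) a‖⁻¹ • awayFrom (K.erase a) a

/-- The surface measure `ds` on a facet: `(d-1)`-dimensional Hausdorff measure, normalized so that
it agrees with Lebesgue measure on hyperplanes. -/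
def facetMeasure {d : ℕ} (F : Finset (Pt d)) : Measure (Pt d) :=
  (μHE[d - 1] : Measure (Pt d)).restrict (closedSimplex F)

namespace Mesh

/-- The triangulated domain `Ω`. -/
def domain {d : ℕ} (M : Mesh d) : Set (Pt d) := interior (⋃ K ∈ M.cells, closedSimplex K)

/-- The facets of the triangulation, including the exterior ones. -/
def facets {d : ℕ} (M : Mesh d) : Set (Finset (Pt d)) :=
  {F | F.card = d ∧ ∃ K ∈ M.cells, F ⊆ K}

/-- The cells having `F` as a facet. -/
def adjacent {d : ℕ} (M : Mesh d) (F : Finset (Pt d)) : Finset (Finset (Pt d)) :=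
  M.cells.filter (fun K => F ⊆ K)

/-- The exterior facets, which make up `∂Ω`: those belonging to exactly one cell. -/
def exteriorFacets {d : ℕ} (M : Mesh d) : Set (Finset (Pt d)) :=
  {F | F ∈ M.facets ∧ (M.adjacent F).card = 1}

/-- `Σ_K ∫_K g_K dx`. -/
def sumCells {d : ℕ} (M : Mesh d) (g : Finset (Pt d) → Pt d → ℝ) : ℝ :=
  ∑ K ∈ M.cells, ∫ x in openCell K, g K x

/-- `Σ_K ∫_{∂K} g ds`. The integrand may depend on the cell `K`, the facet `F` of `K`, the outward
unit normal `n` of `K` on `F`, and the point `x`. -/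
def sumBoundaries {d : ℕ} (M : Mesh d)
    (g : Finset (Pt d) → Finset (Pt d) → Pt d → Pt d → ℝ) : ℝ :=
  ∑ K ∈ M.cells, ∑ a ∈ K, ∫ x, g K (K.erase a) (outwardNormal K a) x ∂(facetMeasure (K.erase a))

/-- `∫_Γ g ds` for a set `Γ` of exterior facets. An exterior facet lies in one cell `K` only, and
the outward unit normal of `Ω` on it is that of `K`. -/
def integralOn {d : ℕ} (M : Mesh d) (Γ : Set (Finset (Pt d)))
    (g : Finset (Pt d) → Finset (Pt d) → Pt d → Pt d → ℝ) : ℝ :=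
  ∑ K ∈ M.cells, ∑ a ∈ K with K.erase a ∈ Γ,
    ∫ x, g K (K.erase a) (outwardNormal K a) x ∂(facetMeasure (K.erase a))

/-- The function on `Ω` (defined up to a null set) whose restriction to each open cell `K`
is `v K`. -/
def glue {d : ℕ} (M : Mesh d) (v : Finset (Pt d) → Pt d → Pt d) (x : Pt d) : Pt d :=
  ∑ K ∈ M.cells, (openCell K).indicator (v K) x

/-- The triangulation with the cell size measure `h_K` is regular with constant `σ`: `h_K` is
comparable to the diameter of `K`, every cell contains a ball of radius comparable to its
diameter, and the size measures of cells sharing a facet are comparable. -/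
def Regular {d : ℕ} (M : Mesh d) (h : Finset (Pt d) → ℝ) (σ : ℝ) : Prop :=
  (∀ K ∈ M.cells, σ⁻¹ * Metric.diam (closedSimplex K) ≤ h K ∧
      h K ≤ σ * Metric.diam (closedSimplex K)) ∧
  (∀ K ∈ M.cells, ∃ c, Metric.closedBall c (σ⁻¹ * Metric.diam (closedSimplex K))
      ⊆ closedSimplex K) ∧
  (∀ K ∈ M.cells, ∀ L ∈ M.cells, (K ∩ L).card = d → h K ≤ σ * h L)

end Mesh

/-! ### Finite element functions -/

/-- `g` is a polynomial function of total degree at most `k`. -/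
def IsPoly {d : ℕ} (k : ℕ) (g : Pt d → ℝ) : Prop :=
  ∃ P : MvPolynomial (Fin d) ℝ, P.totalDegree ≤ k ∧ ∀ x, g x = MvPolynomial.eval (fun i => x i) P

/-- `v` is a vector field with polynomial components of total degree at most `k`. -/
def IsVecPoly {d : ℕ} (k : ℕ) (v : Pt d → Pt d) : Prop := ∀ i, IsPoly k (fun x => v x i)

/-- A quadruple `(u, ū, p, p̄)`, or `(v, v̄, q, q̄)`. The functions `u K`, `p K` are the ones on the
cell `K`, and only their values on the closed cell matter; the functions `ubar F`, `pbar F` are the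
ones on the facet `F`, and only their values on `F` matter. -/
structure Fields (d : ℕ) where
  u : Finset (Pt d) → Pt d → Pt d
  ubar : Finset (Pt d) → Pt d → Pt d
  p : Finset (Pt d) → Pt d → ℝ
  pbar : Finset (Pt d) → Pt d → ℝ

/-- `U_{n+θ} = (1-θ) U_n + θ U_{n+1}`. -/
def Fields.mid {d : ℕ} (θ : ℝ) (U U' : Fields d) : Fields d where
  u K x := (1 - θ) • U.u K x + θ • U'.u K x
  ubar F x := (1 - θ) • U.ubar F x + θ • U'.ubar F x
  p K x := (1 - θ) * U.p K x + θ * U'.p K x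
  pbar F x := (1 - θ) * U.pbar F x + θ * U'.pbar F x

/-- The data of the method: the triangulation, the cell size measure `h_K`, the Dirichlet part
`Γ_D` of the boundary (a set of exterior facets), the polynomial orders on cells and facets,
whether the facet functions are required to be continuous on the union of all facets, and the
parameters `χ`, `ν`, `α`, `β`. -/
structure Scheme (d : ℕ) where
  mesh : Mesh d
  cellSize : Finset (Pt d) → ℝ
  ΓD : Set (Finset (Pt d))
  k : ℕ
  kbar : ℕ
  m : ℕ
  mbar : ℕ
  continuousFacets : Prop
  χ : ℝ
  ν : ℝ
  α : ℝ
  β : ℝ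

/-- The data of one time step: `θ`, the time increment `δt`, the forcing term `f_{n+θ}` and the
Neumann datum `h_{n+θ}`. -/
structure Step (d : ℕ) where
  θ : ℝ
  δt : ℝ
  f : Pt d → Pt d
  h : Pt d → Pt d

namespace Scheme

/-- `Γ_N`, the part of the boundary not in `Γ_D`. -/
def ΓN {d : ℕ} (S : Scheme d) : Set (Finset (Pt d)) := S.mesh.exteriorFacets \ S.ΓD

/-- The size measure on a facet: the average of `h_K` over the adjacent cells. -/
def facetSize {d : ℕ} (S : Scheme d) (F : Finset (Pt d)) : ℝ :=
  (∑ K ∈ S.mesh.adjacent F, S.cellSize K) / (S.mesh.adjacent F).card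

/-- A family of functions on facets fits together to a continuous function on the union of all
facets. -/
def FacetContinuous {d : ℕ} (S : Scheme d) {Y : Type} (g : Finset (Pt d) → Pt d → Y) : Prop :=
  ∀ F ∈ S.mesh.facets, ∀ G ∈ S.mesh.facets, ∀ x ∈ closedSimplex F ∩ closedSimplex G,
    g F x = g G x

/-- Membership in the finite element space `V_h × V̄_h × Q_h × Q̄_h`, or, if continuous facet
functions are required, in `V_h × V̄*_h × Q_h × Q̄*_h`. -/
def InSpace {d : ℕ} (S : Scheme d) (U : Fields d) : Prop :=
  (∀ K ∈ S.mesh.cells, IsVecPoly S.k (U.u K)) ∧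
  (∀ F ∈ S.mesh.facets, IsVecPoly S.kbar (U.ubar F)) ∧
  (∀ F ∈ S.ΓD, ∀ x ∈ closedSimplex F, U.ubar F x = 0) ∧
  (∀ K ∈ S.mesh.cells, IsPoly S.m (U.p K)) ∧
  (∀ F ∈ S.mesh.facets, IsPoly S.mbar (U.pbar F)) ∧
  (S.continuousFacets → S.FacetContinuous U.ubar ∧ S.FacetContinuous U.pbar)

end Scheme

/-! ### Tensors and fluxes

Second-order tensors are linear maps; `∇v` is `fderiv ℝ v`, with entries `∂v_i/∂x_j`, and
`a ⊗ b` is `InnerProductSpace.rankOne ℝ a b`, with entries `a_i b_j`. -/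

/-- The symmetric gradient `∇ˢv = (∇v + ∇vᵀ)/2`. -/
def symGrad {d : ℕ} (v : Pt d → Pt d) (x : Pt d) : Pt d →L[ℝ] Pt d :=
  (1 / 2 : ℝ) • (fderiv ℝ v x + ContinuousLinearMap.adjoint (fderiv ℝ v x))

/-- The double contraction `A : B = Σ_ij A_ij B_ij`. -/
def contract {d : ℕ} (A B : Pt d →L[ℝ] Pt d) : ℝ :=
  ∑ i : Fin d, ∑ j : Fin d,
    A (EuclideanSpace.single j 1) i * B (EuclideanSpace.single j 1) i

namespace Scheme

/-- The numerical mass flux `û = u - β h_K / (ν + 1) (p̄ - p) n` on the facet `F` of `K`. -/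
def uhat {d : ℕ} (S : Scheme d) (U : Fields d) (K F : Finset (Pt d)) (n x : Pt d) : Pt d :=
  U.u K x - (S.β * S.facetSize F / (S.ν + 1) * (U.pbar F x - U.p K x)) • n

/-- The upwinding switch `λ`: one where `û · n < 0`, zero where `û · n ≥ 0`. -/
def lam {d : ℕ} (S : Scheme d) (U : Fields d) (K F : Finset (Pt d)) (n x : Pt d) : ℝ :=
  if inner ℝ (S.uhat U K F n x) n < 0 then 1 else 0

/-- The diffusive flux `σ_d = p I - 2ν ∇ˢu` on the cell `K`. -/
def sigmaD {d : ℕ} (S : Scheme d) (U : Fields d) (K : Finset (Pt d)) (x : Pt d) :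
    Pt d →L[ℝ] Pt d :=
  U.p K x • ContinuousLinearMap.id ℝ (Pt d) - (2 * S.ν) • symGrad (U.u K) x

/-- The numerical diffusive flux `σ̂_d = p̄ I - 2ν ∇ˢu - (α / h_K) 2ν (ū - u) ⊗ n` on the facet `F`
of `K`. -/
def sigmaDhat {d : ℕ} (S : Scheme d) (U : Fields d) (K F : Finset (Pt d)) (n x : Pt d) :
    Pt d →L[ℝ] Pt d :=
  U.pbar F x • ContinuousLinearMap.id ℝ (Pt d) - (2 * S.ν) • symGrad (U.u K) x
    - (S.α / S.facetSize F * (2 * S.ν)) •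
        InnerProductSpace.rankOne ℝ (U.ubar F x - U.u K x) n

/-! ### The functionals of the fully discrete method -/

/-- The local continuity functional `F_c(U; q)`. -/
def Fc {d : ℕ} (S : Scheme d) (U : Fields d) (q : Finset (Pt d) → Pt d → ℝ) : ℝ :=
  S.mesh.sumCells (fun K x => inner ℝ (U.u K x) (gradient (q K) x))
  - S.mesh.sumBoundaries (fun K F n x => inner ℝ (S.uhat U K F n x) n * q K x)

/-- The global continuity functional `F̄_c(U; q̄)`. -/
def Fcbar {d : ℕ} (S : Scheme d) (U : Fields d) (qbar : Finset (Pt d) → Pt d → ℝ) : ℝ :=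
  S.mesh.sumBoundaries (fun K F n x => inner ℝ (S.uhat U K F n x) n * qbar F x)
  - S.mesh.integralOn S.mesh.exteriorFacets
      (fun _ F n x => inner ℝ (U.ubar F x) n * qbar F x)

/-- The time-discrete local momentum functional `F_{δt,m}(U_{n+1}; v)`, where `U` is `U_n` and
`U'` is `U_{n+1}`. The advective velocity and `λ` are taken at time `t_n`. -/
def Fm {d : ℕ} (S : Scheme d) (τ : Step d) (U U' : Fields d)
    (v : Finset (Pt d) → Pt d → Pt d) : ℝ :=
  let Uθ := Fields.mid τ.θ U U'
  (∫ x in S.mesh.domain,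
      inner ℝ (τ.δt⁻¹ • (S.mesh.glue U'.u x - S.mesh.glue U.u x)) (S.mesh.glue v x))
  - S.χ * S.mesh.sumCells (fun K x =>
      contract (InnerProductSpace.rankOne ℝ (Uθ.u K x) (U.u K x)) (fderiv ℝ (v K) x))
  + (1 - S.χ) * S.mesh.sumCells (fun K x =>
      inner ℝ (fderiv ℝ (Uθ.u K) x (U.u K x)) (v K x))
  + S.χ * S.mesh.sumBoundaries (fun K F n x =>
      inner ℝ (S.uhat U K F n x) n * inner ℝ (Uθ.u K x) (v K x))
  + S.mesh.sumBoundaries (fun K F n x =>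
      S.lam U K F n x * inner ℝ (S.uhat U K F n x) n *
        inner ℝ (Uθ.ubar F x - Uθ.u K x) (v K x))
  - S.mesh.sumCells (fun K x => contract (S.sigmaD Uθ K x) (fderiv ℝ (v K) x))
  + S.mesh.sumBoundaries (fun K F n x => inner ℝ (S.sigmaDhat Uθ K F n x n) (v K x))
  + S.mesh.sumBoundaries (fun K F n x =>
      2 * S.ν * inner ℝ (Uθ.ubar F x - Uθ.u K x) (symGrad (v K) x n))
  - ∫ x in S.mesh.domain, inner ℝ (τ.f x) (S.mesh.glue v x)

/-- The time-discrete global momentum functional `F̄_{δt,m}(U_{n+1}; v̄)`, where `U` is `U_n` and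
`U'` is `U_{n+1}`. -/
def Fmbar {d : ℕ} (S : Scheme d) (τ : Step d) (U U' : Fields d)
    (vbar : Finset (Pt d) → Pt d → Pt d) : ℝ :=
  let Uθ := Fields.mid τ.θ U U'
  S.χ * S.mesh.sumBoundaries (fun K F n x =>
      inner ℝ (S.uhat U K F n x) n * inner ℝ (Uθ.u K x) (vbar F x))
  - (1 - S.χ) * S.mesh.sumBoundaries (fun K F n x =>
      inner ℝ (S.uhat U K F n x) n * inner ℝ (Uθ.ubar F x - Uθ.u K x) (vbar F x))
  + S.mesh.sumBoundaries (fun K F n x =>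
      S.lam U K F n x * inner ℝ (S.uhat U K F n x) n *
        inner ℝ (Uθ.ubar F x - Uθ.u K x) (vbar F x))
  + S.mesh.sumBoundaries (fun K F n x => inner ℝ (S.sigmaDhat Uθ K F n x n) (vbar F x))
  - S.mesh.integralOn S.ΓN (fun K F n x =>
      (S.χ - S.lam U K F n x) * inner ℝ (U.ubar F x) n * inner ℝ (Uθ.ubar F x) (vbar F x))
  - S.mesh.integralOn S.ΓN (fun _ F _ x => inner ℝ (τ.h x) (vbar F x))

/-- The functional `F_{δt}(U_{n+1}; W)` of the fully discrete problem. -/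
def Ftotal {d : ℕ} (S : Scheme d) (τ : Step d) (U U' W : Fields d) : ℝ :=
  S.Fm τ U U' W.u + S.Fmbar τ U U' W.ubar + S.Fc U' W.p + S.Fcbar U' W.pbar

/-- Admissible data of a time step: `θ ∈ [0,1]`, `δt > 0`, `f_{n+θ} ∈ L²(Ω)^d`,
`h_{n+θ} ∈ L²(Γ_N)^d`. -/
def StepAdmissible {d : ℕ} (S : Scheme d) (τ : Step d) : Prop :=
  0 ≤ τ.θ ∧ τ.θ ≤ 1 ∧ 0 < τ.δt ∧
  MemLp τ.f 2 (volume.restrict S.mesh.domain) ∧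
  ∀ F ∈ S.ΓN, MemLp τ.h 2 (facetMeasure F)

/-- Given `U = U_n` in the finite element space, `U' = U_{n+1}` solves the fully discrete problem
at time `t_{n+1}`: it lies in the finite element space and `F_{δt}(U_{n+1}; W) = 0` for all `W` in
the finite element space. -/
def Solves {d : ℕ} (S : Scheme d) (τ : Step d) (U U' : Fields d) : Prop :=
  S.StepAdmissible τ ∧ S.InSpace U ∧ S.InSpace U' ∧
    ∀ W : Fields d, S.InSpace W → S.Ftotal τ U U' W = 0

end Scheme

end HybridNS

end

/-!
The kinetic energy is bounded by testing the momentum equations with `(u, -ū)`, where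
`(u, ū, p, p̄)` are the fields at the intermediate time level `n + θ`, and the continuity equations
with `(p, p̄)`. With `w = û_n · n`, each group of terms has a sign.

* Convection (`Scheme.InSpace.convection_nonneg`): for `χ = 1/2` the volume terms cancel pointwise
  and the facet terms combine to `(1/2 - λ) w |ū - u|² = |w| |ū - u|² / 2`. No
  divergence constraint on `u_n` is used.
* Pressure (`Scheme.InSpace.pressure_nonneg`): `U_n` and `U_{n+1}` both satisfy the continuity
  equations, hence so do the intermediate fields. Integrating by parts on every cell and using that
  the flux of the single-valued field `p̄ ū` through the interior facets cancels, what is left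
  is the stabilization `β h_K / (ν + 1) (p̄ - p)²`.
* Viscosity (`Scheme.InSpace.viscous_nonneg`): by Young's inequality the consistency terms
  are absorbed by the penalty and by `2ν |∇ˢu|²`, provided `α` exceeds the constant of the
  discrete trace inequality `exists_weighted_trace_inequality`.
* Time (`Scheme.InSpace.energy_le`): `(u_{n+1} - u_n) · u_{n+θ}` is half the increment of `|u|²`
  plus `(θ - 1/2) |u_{n+1} - u_n|²`.

Three facts about simplices carry the argument.

The divergence theorem on a simplex `K` (`IsSimplex.integral_divergence`): let `n_b` be the normal
opposite to the vertex `b` and `H_b` the height. As `-n_b / H_b` is the gradient of the barycentric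
coordinate of `b`, every field is `v(x) = ∑_b (v(x) · n_b / H_b) (x - b)`, and for a field
`φ(x) (x - b)` that is radial from `b` the theorem follows by integrating along the rays from `b`,
since `d/dt [t^d φ(b + t (y - b))]` is `t^(d-1)` times the divergence of `φ(x) (x - b)`.

Two cells with a common facet have opposite normals on it (`Mesh.outwardNormal_eq_neg`): otherwise
they would overlap near the barycentre of the facet, against conformity. In particular a facet
belongs to at most two cells.

The trace inequality (`exists_trace_inequality`): if `K` contains the ball of centre `c` and radius
`ρ`, the flux of `x - c` bounds the surface area of `K` by `d |K| / ρ`. The maximum of a polynomial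
of bounded degree on `K` is bounded by its `L²` norm on the ball, since all norms on a
finite-dimensional space are equivalent, with the constant made explicit by scaling.
-/

namespace HybridNS

open scoped RealInnerProductSpace

/-! ### Heights and normals of a simplex -/

/-- `K` is the vertex set of a nondegenerate `d`-simplex in `ℝ^d`. -/
def IsSimplex {d : ℕ} (K : Finset (Pt d)) : Prop :=
  K.card = d + 1 ∧ AffineIndependent ℝ (fun a : K => (a : Pt d))

theorem Mesh.isSimplex {d : ℕ} (M : Mesh d) {K : Finset (Pt d)} (hK : K ∈ M.cells) :
    IsSimplex K :=
  ⟨M.card_cell K hK, M.indep K hK⟩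

/-- The distance of the vertex `a` of `K` from the hyperplane of the opposite facet. -/
noncomputable def height {d : ℕ} (K : Finset (Pt d)) (a : Pt d) : ℝ := ‖awayFrom (K.erase a) a‖

section Simplex

variable {d : ℕ} {K : Finset (Pt d)} {a b : Pt d}

theorem IsSimplex.card_erase (hK : IsSimplex K) (ha : a ∈ K) : (K.erase a).card = d := by
  rw [Finset.card_erase_of_mem ha, hK.1]; rfl

theorem barycenter_sub_mem_vectorSpan {F : Finset (Pt d)} (hb : b ∈ F) :
    ((F.card : ℝ)⁻¹ • (∑ c ∈ F, c) - b) ∈ vectorSpan ℝ (F : Set (Pt d)) := by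
  have hF : (F.card : ℝ) ≠ 0 := by
    exact_mod_cast (Finset.card_pos.2 ⟨b, hb⟩).ne'
  have : (F.card : ℝ)⁻¹ • (∑ c ∈ F, c) - b = (F.card : ℝ)⁻¹ • ∑ c ∈ F, (c - b) := by
    rw [Finset.sum_sub_distrib, smul_sub, Finset.sum_const, ← Nat.cast_smul_eq_nsmul ℝ, smul_smul,
      inv_mul_cancel₀ hF, one_smul]
  rw [this]
  exact Submodule.smul_mem _ _ (Submodule.sum_mem _ fun c hc =>
    vsub_mem_vectorSpan ℝ (Finset.mem_coe.2 hc) (Finset.mem_coe.2 hb))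

theorem IsSimplex.awayFrom_ne_zero (hd : 0 < d) (hK : IsSimplex K) (ha : a ∈ K) :
    awayFrom (K.erase a) a ≠ 0 := by
  intro h
  have hF := hK.card_erase ha
  obtain ⟨b, hb⟩ : (K.erase a).Nonempty := by rw [← Finset.card_pos]; omega
  rw [awayFrom, Submodule.starProjection_apply_eq_zero_iff, Submodule.orthogonal_orthogonal] at h
  have h2 : a - b ∈ vectorSpan ℝ ((K.erase a : Finset (Pt d)) : Set (Pt d)) := by
    have := Submodule.sub_mem _ (barycenter_sub_mem_vectorSpan hb) h
    rwa [sub_sub_sub_cancel_left] at this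
  have h3 : a ∈ affineSpan ℝ ((K.erase a : Finset (Pt d)) : Set (Pt d)) := by
    have hb' := mem_affineSpan ℝ (Finset.mem_coe.2 hb)
    have := AffineSubspace.vadd_mem_of_mem_direction
      (by rwa [direction_affineSpan] : a - b ∈ (affineSpan ℝ _).direction) hb'
    simpa using this
  have h4 := hK.2.notMem_affineSpan_sdiff ⟨a, ha⟩ Set.univ
  apply h4
  convert h3 using 2
  ext x
  simp [and_comm]

theorem IsSimplex.height_pos (hd : 0 < d) (hK : IsSimplex K) (ha : a ∈ K) : 0 < height K a :=
  norm_pos_iff.2 (hK.awayFrom_ne_zero hd ha)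

theorem IsSimplex.norm_outwardNormal (hd : 0 < d) (hK : IsSimplex K) (ha : a ∈ K) :
    ‖outwardNormal K a‖ = 1 := by
  rw [outwardNormal, norm_smul, norm_inv, norm_norm]
  exact inv_mul_cancel₀ (hK.height_pos hd ha).ne'

theorem IsSimplex.inner_outwardNormal_self (hd : 0 < d) (hK : IsSimplex K) (ha : a ∈ K) :
    ⟪outwardNormal K a, outwardNormal K a⟫ = 1 := by
  rw [real_inner_self_eq_norm_sq, hK.norm_outwardNormal hd ha, one_pow]

theorem inner_awayFrom_of_mem_vectorSpan {F : Finset (Pt d)} {v : Pt d}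
    (hv : v ∈ vectorSpan ℝ (F : Set (Pt d))) : ⟪v, awayFrom F a⟫ = 0 :=
  Submodule.inner_right_of_mem_orthogonal hv (Submodule.starProjection_apply_mem _ _)

theorem inner_barycenter_sub_awayFrom (F : Finset (Pt d)) (a : Pt d) :
    ⟪(F.card : ℝ)⁻¹ • (∑ b ∈ F, b) - a, awayFrom F a⟫ = ‖awayFrom F a‖ ^ 2 := by
  rw [← real_inner_self_eq_norm_sq]
  conv_rhs => rw [awayFrom]
  rw [Submodule.inner_starProjection_left_eq_right]
  congr 1
  exact (Submodule.starProjection_eq_self_iff.2 (Submodule.starProjection_apply_mem _ _)).symm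

theorem inner_sub_awayFrom {F : Finset (Pt d)} (hb : b ∈ F) :
    ⟪b - a, awayFrom F a⟫ = ‖awayFrom F a‖ ^ 2 := by
  rw [← inner_barycenter_sub_awayFrom F a, ← sub_eq_zero, ← inner_sub_left,
    sub_sub_sub_cancel_right, ← neg_sub, inner_neg_left,
    inner_awayFrom_of_mem_vectorSpan (barycenter_sub_mem_vectorSpan hb), neg_zero]

theorem IsSimplex.inner_sub_outwardNormal (hd : 0 < d) (hK : IsSimplex K) (ha : a ∈ K)
    (hb : b ∈ K.erase a) : ⟪b - a, outwardNormal K a⟫ = height K a := by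
  have h := (hK.height_pos hd ha).ne'
  rw [outwardNormal, inner_smul_right, inner_sub_awayFrom hb, ← height]
  field_simp

/-- On the facet opposite to `a`, the distance from `a` along the normal is constant. -/
theorem IsSimplex.inner_sub_outwardNormal_of_mem_facet (hd : 0 < d) (hK : IsSimplex K)
    (ha : a ∈ K) {y : Pt d} (hy : y ∈ closedSimplex (K.erase a)) :
    ⟪y - a, outwardNormal K a⟫ = height K a := by
  have hconv : Convex ℝ {y : Pt d | ⟪y, outwardNormal K a⟫ = height K a + ⟪a, outwardNormal K a⟫} :=
    convex_hyperplane (IsLinearMap.mk (fun x y => inner_add_left x y _)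
      (fun c x => by rw [real_inner_smul_left, smul_eq_mul])) _
  have hsub : closedSimplex (K.erase a) ⊆ _ := convexHull_min (fun b hb => ?_) hconv
  · have := hsub hy
    rw [Set.mem_ofPred_eq] at this
    rw [inner_sub_left, this, add_sub_cancel_right]
  · rw [Set.mem_ofPred_eq, ← hK.inner_sub_outwardNormal hd ha hb, inner_sub_left, sub_add_cancel]

/-- A simplex lies on the inner side of each of its facets. -/
theorem IsSimplex.inner_sub_outwardNormal_le (hd : 0 < d) (hK : IsSimplex K)
    (ha : a ∈ K) {y : Pt d} (hy : y ∈ closedSimplex K) :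
    ⟪y - a, outwardNormal K a⟫ ≤ height K a := by
  have hconv : Convex ℝ {y : Pt d | ⟪y, outwardNormal K a⟫ ≤ height K a + ⟪a, outwardNormal K a⟫} :=
    convex_halfSpace_le (IsLinearMap.mk (fun x y => inner_add_left x y _)
      (fun c x => by rw [real_inner_smul_left, smul_eq_mul])) _
  have hsub : closedSimplex K ⊆ _ := convexHull_min (fun b hb => ?_) hconv
  · have := hsub hy
    rw [Set.mem_ofPred_eq] at this
    rw [inner_sub_left]; linarith
  · rw [Set.mem_ofPred_eq]
    by_cases h : b = a
    · subst h; linarith [(hK.height_pos hd ha)]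
    · rw [← hK.inner_sub_outwardNormal hd ha (Finset.mem_erase.2 ⟨h, hb⟩), inner_sub_left,
        sub_add_cancel]

theorem IsSimplex.vectorSpan_eq_top (hK : IsSimplex K) :
    vectorSpan ℝ (K : Set (Pt d)) = ⊤ := by
  have := hK.2.vectorSpan_eq_top_of_card_eq_finrank_add_one (by simp [hK.1])
  simpa using this

/-- The gradients `-n_b / H_b` of the barycentric coordinates sum to zero, and express every vector
in terms of the vectors from the vertices to an arbitrary point. -/
theorem IsSimplex.sum_inner_outwardNormal_div_height (hd : 0 < d) (hK : IsSimplex K) (w : Pt d) :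
    ∑ b ∈ K, ⟪w, outwardNormal K b⟫ / height K b = 0 ∧
      ∀ x, ∑ b ∈ K, (⟪w, outwardNormal K b⟫ / height K b) • (x - b) = w := by
  have hw : w ∈ vectorSpan ℝ (K : Set (Pt d)) := hK.vectorSpan_eq_top ▸ Submodule.mem_top
  rw [vectorSpan_def] at hw
  induction hw using Submodule.span_induction with
  | zero => simp
  | add u v _ _ hu hv =>
    simp only [inner_add_left, add_div, add_smul, Finset.sum_add_distrib, hu.1, hv.1, hu.2, hv.2,
      add_zero, implies_true, and_self]
  | smul c u _ hu =>
    simp only [real_inner_smul_left, mul_div_assoc, mul_smul, ← Finset.mul_sum, ← Finset.smul_sum,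
      hu.1, hu.2, mul_zero, implies_true, and_self]
  | mem u hu =>
    obtain ⟨p, hp, q, hq, rfl⟩ := hu
    rw [Finset.mem_coe] at hp hq
    have key : ∀ b ∈ K, ⟪p -ᵥ q, outwardNormal K b⟫ / height K b
        = (if b = q then 1 else 0) - (if b = p then 1 else 0) := by
      have aux : ∀ r ∈ K, ∀ b ∈ K, ⟪r - b, outwardNormal K b⟫ / height K b
          = 1 - (if b = r then 1 else 0) := by
        intro r hr b hb
        by_cases h : b = r
        · simp [h]
        · rw [hK.inner_sub_outwardNormal hd hb (Finset.mem_erase.2 ⟨Ne.symm h, hr⟩),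
            div_self (hK.height_pos hd hb).ne', if_neg h, sub_zero]
      intro b hb
      rw [vsub_eq_sub, ← sub_sub_sub_cancel_right p q b, inner_sub_left, sub_div, aux p hp b hb,
        aux q hq b hb]
      ring
    refine ⟨?_, fun x => ?_⟩
    · rw [Finset.sum_congr rfl key]
      simp [hp, hq]
    · rw [Finset.sum_congr rfl fun b hb => by rw [key b hb]]
      simp [sub_smul, hp, hq]

end Simplex

/-! ### Cells sharing a facet -/

section Facets

variable {d : ℕ} {K L : Finset (Pt d)} {a b : Pt d}

theorem IsSimplex.inter_eq_erase (hK : IsSimplex K) (hL : IsSimplex L) (ha : a ∈ K)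
    (h : K.erase a ⊆ L) (hne : K ≠ L) : K ∩ L = K.erase a := by
  symm
  apply Finset.eq_of_subset_of_card_le
  · exact Finset.subset_inter (Finset.erase_subset _ _) h
  · rw [hK.card_erase ha]
    by_contra! h
    have h1 : K ∩ L = K := Finset.eq_of_subset_of_card_le Finset.inter_subset_left
      (by rw [hK.1]; omega)
    have h2 : K ∩ L = L := Finset.eq_of_subset_of_card_le Finset.inter_subset_right
      (by rw [hL.1]; omega)
    exact hne (h1.symm.trans h2)

theorem IsSimplex.exists_erase_eq (hL : IsSimplex L) {F : Finset (Pt d)} (hF : F.card = d)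
    (h : F ⊆ L) : ∃ b ∈ L, L.erase b = F := by
  have h1 : (L \ F).card = 1 := by
    have := Finset.card_sdiff_add_card_eq_card h
    rw [hL.1] at this
    omega
  obtain ⟨b, hb⟩ := Finset.card_eq_one.1 h1
  have hbL : b ∈ L \ F := hb ▸ Finset.mem_singleton_self b
  refine ⟨b, (Finset.mem_sdiff.1 hbL).1, ?_⟩
  rw [Finset.erase_eq, ← hb, Finset.sdiff_sdiff_eq_self h]

/-- Moving slightly from the barycentre of a facet of `L` to the inner side stays in `L`. -/
theorem IsSimplex.eventually_mem_closedSimplex (hd : 0 < d) (hL : IsSimplex L) (hb : b ∈ L)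
    {w : Pt d} (hw : ⟪w, outwardNormal L b⟫ ≤ 0) :
    ∀ᶠ ε in nhdsWithin (0 : ℝ) (Set.Ioi 0),
      ((L.erase b).card : ℝ)⁻¹ • (∑ c ∈ L.erase b, c) + ε • w ∈ closedSimplex L := by
  obtain ⟨h0, h1⟩ := hL.sum_inner_outwardNormal_div_height hd w
  set γ : Pt d → ℝ := fun p => ⟪w, outwardNormal L p⟫ / height L p with hγ
  have hcard := hL.card_erase hb
  have hd' : (0 : ℝ) < d := by exact_mod_cast hd
  have hpos : ∀ᶠ ε in nhdsWithin (0 : ℝ) (Set.Ioi 0),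
      ∀ p ∈ L, 0 ≤ (if p = b then 0 else (d : ℝ)⁻¹) - ε * γ p := by
    rw [Finset.eventually_all]
    intro p hp
    by_cases hpb : p = b
    · subst hpb
      filter_upwards [self_mem_nhdsWithin] with ε (hε : 0 < ε)
      have : γ p ≤ 0 := div_nonpos_of_nonpos_of_nonneg hw (hL.height_pos hd hp).le
      simp only [if_true, zero_sub, Left.nonneg_neg_iff]
      exact mul_nonpos_of_nonneg_of_nonpos hε.le this
    · simp only [hpb, if_false]
      have : Filter.Tendsto (fun ε : ℝ => (d : ℝ)⁻¹ - ε * γ p) (nhdsWithin 0 (Set.Ioi 0))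
          (nhds ((d : ℝ)⁻¹ - 0 * γ p)) :=
        ((by fun_prop : Continuous fun ε : ℝ => (d : ℝ)⁻¹ - ε * γ p).tendsto 0).mono_left
          nhdsWithin_le_nhds
      rw [zero_mul, sub_zero] at this
      exact (this.eventually (lt_mem_nhds (inv_pos.2 hd'))).mono fun _ h => h.le
  filter_upwards [hpos] with ε hε
  have hsum : ∑ p ∈ L, ((if p = b then 0 else (d : ℝ)⁻¹) - ε * γ p) = 1 := by
    rw [Finset.sum_sub_distrib, ← Finset.mul_sum, h0, mul_zero, sub_zero,
      ← Finset.add_sum_erase _ _ hb, if_pos rfl, zero_add,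
      Finset.sum_congr rfl fun p hp => if_neg (Finset.ne_of_mem_erase hp), Finset.sum_const, hcard,
      nsmul_eq_mul, mul_inv_cancel₀ hd'.ne']
  have hmem := (convex_convexHull ℝ (L : Set (Pt d))).sum_mem hε hsum
    (fun p hp => subset_convexHull ℝ _ (Finset.mem_coe.2 hp))
  suffices heq : ∑ p ∈ L, ((if p = b then 0 else (d : ℝ)⁻¹) - ε * γ p) • p
      = ((L.erase b).card : ℝ)⁻¹ • (∑ c ∈ L.erase b, c) + ε • w by
    rwa [heq] at hmem
  have h2 : -∑ p ∈ L, γ p • p = w := by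
    rw [← h1 0, ← Finset.sum_neg_distrib]
    exact Finset.sum_congr rfl fun p _ => by rw [zero_sub, smul_neg]
  simp only [sub_smul, Finset.sum_sub_distrib, mul_smul, ← Finset.smul_sum]
  rw [sub_eq_add_neg, ← smul_neg, ← h2, hcard, ← Finset.add_sum_erase _ _ hb, if_pos rfl, zero_smul,
    zero_add, Finset.smul_sum]
  congr 1
  exact Finset.sum_congr rfl fun p hp => by rw [if_neg (Finset.ne_of_mem_erase hp)]

/-- Two distinct cells with a common facet lie on opposite sides of it: otherwise they would
overlap near the barycentre of the facet, against conformity. -/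
theorem Mesh.outwardNormal_eq_neg (M : Mesh d) (hd : 0 < d) (hK : K ∈ M.cells) (hL : L ∈ M.cells)
    (ha : a ∈ K) (hb : b ∈ L) (hF : K.erase a = L.erase b) (hne : K ≠ L) :
    outwardNormal L b = -outwardNormal K a := by
  have sK := M.isSimplex hK
  have sL := M.isSimplex hL
  set F := K.erase a with hFdef
  have hKL : K ∩ L = F := sK.inter_eq_erase sL ha
    (by rw [← hFdef, hF]; exact Finset.erase_subset _ _) hne
  -- both normals span the one-dimensional orthogonal complement of the facet
  have hfin : Module.finrank ℝ ((vectorSpan ℝ (F : Set (Pt d)))ᗮ : Submodule ℝ (Pt d)) = 1 := by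
    have hiF : AffineIndependent ℝ (fun p : F => (p : Pt d)) :=
      sK.2.mono (Finset.erase_subset a K)
    have h1 : Module.finrank ℝ (vectorSpan ℝ (F : Set (Pt d))) = d - 1 := by
      have := hiF.finrank_vectorSpan (n := d - 1)
        (by simp only [Fintype.card_coe]; rw [sK.card_erase ha]; omega)
      have hr : Set.range (fun p : F => (p : Pt d)) = (F : Set (Pt d)) := by ext; simp
      rwa [hr] at this
    have h2 := Submodule.finrank_add_finrank_orthogonal (vectorSpan ℝ (F : Set (Pt d)))
    rw [h1, finrank_euclideanSpace_fin] at h2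
    omega
  have hmem : ∀ c : Pt d, awayFrom F c ∈ (vectorSpan ℝ (F : Set (Pt d)))ᗮ := fun c =>
    Submodule.starProjection_apply_mem _ _
  have hwa := sK.awayFrom_ne_zero hd ha
  have hwb := sL.awayFrom_ne_zero hd hb
  rw [← hF] at hwb
  rw [← hFdef] at hwa
  obtain ⟨c, hc⟩ : ∃ c : ℝ, c • awayFrom F a = awayFrom F b := by
    obtain ⟨c, hc⟩ := (finrank_eq_one_iff_of_nonzero' (⟨_, hmem a⟩ :
      ((vectorSpan ℝ (F : Set (Pt d)))ᗮ : Submodule ℝ (Pt d)))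
      (by simpa [Subtype.ext_iff] using hwa)).1 hfin ⟨_, hmem b⟩
    exact ⟨c, congrArg Subtype.val hc⟩
  have hc0 : c ≠ 0 := by
    rintro rfl
    rw [zero_smul] at hc
    exact hwb hc.symm
  have hnK : outwardNormal K a = ‖awayFrom F a‖⁻¹ • awayFrom F a := rfl
  have hnL : outwardNormal L b = ‖awayFrom F b‖⁻¹ • awayFrom F b := by rw [outwardNormal, hF]
  have hcneg : c < 0 := by
    by_contra! hc'
    set β : Pt d := (F.card : ℝ)⁻¹ • (∑ c ∈ F, c) with hβ
    have hip : 0 < ⟪β - a, awayFrom F a⟫ := by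
      rw [inner_barycenter_sub_awayFrom]
      exact pow_pos (norm_pos_iff.2 hwa) 2
    have e1 := sK.eventually_mem_closedSimplex hd ha (w := a - β) (by
      rw [hnK, inner_smul_right, ← neg_sub, inner_neg_left]
      have := mul_pos (inv_pos.2 (norm_pos_iff.2 hwa)) hip
      linarith)
    have e2 := sL.eventually_mem_closedSimplex hd hb (w := a - β) (by
      rw [hnL, inner_smul_right, ← neg_sub, inner_neg_left, ← hc, inner_smul_right]
      have := mul_nonneg (inv_pos.2 (norm_pos_iff.2 hwb)).le (mul_nonneg hc' hip.le)
      rw [← hc] at this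
      linarith)
    rw [← hF] at e2
    obtain ⟨ε, ⟨h1, h2⟩, hε⟩ := ((e1.and e2).and self_mem_nhdsWithin).exists
    have hε : 0 < ε := hε
    have h3 : β + ε • (a - β) ∈ closedSimplex (K.erase a) := by
      have : β + ε • (a - β) ∈ convexHull ℝ (K : Set (Pt d)) ∩ convexHull ℝ (L : Set (Pt d)) :=
        ⟨h1, h2⟩
      rw [M.conforming K hK L hL, hKL] at this
      exact this
    have h4 := sK.inner_sub_outwardNormal_of_mem_facet hd ha h3
    have h5 : ⟪β - a, outwardNormal K a⟫ = height K a := by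
      rw [hnK, inner_smul_right, inner_barycenter_sub_awayFrom, height, ← hFdef]
      have := (norm_pos_iff.2 hwa).ne'
      field_simp
    have h6 : β + ε • (a - β) - a = (β - a) - ε • (β - a) := by
      rw [← neg_sub β a, smul_neg]; abel
    rw [h6, inner_sub_left, real_inner_smul_left, h5] at h4
    have := mul_pos hε (sK.height_pos hd ha)
    linarith
  rw [hnK, hnL, ← hc, norm_smul, smul_smul, ← neg_smul, Real.norm_of_nonpos hcneg.le]
  congr 1
  have := norm_pos_iff.2 hwa
  field_simp

end Facets

/-! ### Integration over cones and the divergence theorem on a simplex -/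

section Cone

variable {d : ℕ}

/-- The hyperplane through the origin with normal `n`. -/
noncomputable abbrev hyper (n : Pt d) : Submodule ℝ (Pt d) := (Submodule.span ℝ {n})ᗮ

theorem finrank_hyper {n : Pt d} (hn : ‖n‖ = 1) : Module.finrank ℝ (hyper n) = d - 1 := by
  have h2 := Submodule.finrank_add_finrank_orthogonal (Submodule.span ℝ {n})
  rw [finrank_span_singleton (by rintro rfl; simp at hn), finrank_euclideanSpace_fin] at h2
  change Module.finrank ℝ ↥(Submodule.span ℝ {n})ᗮ = d - 1
  omega

theorem exists_measurableEquiv_prod_hyper (a : Pt d) {n : Pt d} (hn : ‖n‖ = 1) :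
    ∃ e : (ℝ × hyper n) ≃ᵐ Pt d, MeasurePreserving e volume volume ∧
      ∀ p, e p = a + p.1 • n + p.2 := by
  have h1 := Submodule.measurePreserving_measurableEquivProd (Submodule.span ℝ {n}) a
  rw [finrank_euclideanSpace_fin, EuclideanSpace.euclideanHausdorffMeasure_eq_volume] at h1
  let τ := LinearIsometryEquiv.toSpanUnitSingleton (𝕜 := ℝ) n hn
  have h2 : MeasurePreserving (Prod.map τ (id : hyper n → hyper n))
      (volume.prod volume) (volume.prod volume) :=
    τ.measurePreserving.prod (MeasurePreserving.id _)
  refine ⟨(MeasurableEquiv.prodCongr τ.toHomeomorph.toMeasurableEquiv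
    (MeasurableEquiv.refl _)).trans
    (Submodule.measurableEquivProd (Submodule.span ℝ {n}) a).symm, ?_, fun p => ?_⟩
  · exact (h1.symm _).comp h2
  · rw [MeasurableEquiv.trans_apply, Submodule.measurableEquivProd_symm_apply]
    simp [τ, MeasurableEquiv.prodCongr, MeasurableEquiv.refl]
    abel

theorem isometry_add_hyper (n c : Pt d) : Isometry (fun z : hyper n => c + (z : Pt d)) :=
  (IsometryEquiv.addLeft c).isometry.comp isometry_subtype_coe

/-- The `(d-1)`-dimensional Hausdorff measure on a subset of a hyperplane is the Lebesgue measure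
of the hyperplane. -/
theorem map_volume_hyper (c : Pt d) {n : Pt d} (hn : ‖n‖ = 1) (F : Set (Pt d))
    (hFm : MeasurableSet F) (hF : ∀ y ∈ F, y - c ∈ hyper n) :
    (volume.restrict ((fun z : hyper n => c + (z : Pt d)) ⁻¹' F)).map
        (fun z : hyper n => c + (z : Pt d))
      = (μHE[d - 1] : Measure (Pt d)).restrict F := by
  have hi := isometry_add_hyper n c
  rw [← Measure.restrict_map hi.continuous.measurable hFm,
    ← InnerProductSpace.euclideanHausdorffMeasure_eq_volume, finrank_hyper hn,
    hi.map_euclideanHausdorffMeasure, Measure.restrict_restrict hFm, Set.inter_eq_left.2]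
  intro y hy
  exact ⟨⟨y - c, hF y hy⟩, by simp⟩

/-- Integration over the cone with apex `a` and base `a + H n + C`, where `C` is orthogonal to the
unit vector `n`. -/
theorem integral_cone (a : Pt d) {n : Pt d} (hn : ‖n‖ = 1) {H : ℝ} (hH : 0 < H)
    {C : Set (hyper n)} (hC : IsCompact C) {K : Set (Pt d)} (hKc : IsCompact K)
    (hK : ∀ x, x ∈ K ↔ ∃ t ∈ Set.Icc (0 : ℝ) 1, ∃ z ∈ C, x = a + t • (H • n + (z : Pt d)))
    {g : Pt d → ℝ} (hg : Continuous g) :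
    ∫ x in K, g x = H * ∫ z in C, ∫ t in (0 : ℝ)..1,
      t ^ (d - 1) * g (a + t • (H • n + (z : Pt d))) := by
  obtain ⟨e, he, hep⟩ := exists_measurableEquiv_prod_hyper a hn
  set G : Pt d → ℝ := K.indicator g with hG
  have hGi : Integrable G := (hg.continuousOn.integrableOn_compact hKc).integrable_indicator
    hKc.measurableSet
  have hnn : ⟪n, n⟫ = 1 := by rw [real_inner_self_eq_norm_sq, hn, one_pow]
  have hzn : ∀ z : hyper n, ⟪(z : Pt d), n⟫ = 0 := fun z =>
    Submodule.inner_left_of_mem_orthogonal (Submodule.mem_span_singleton_self n) z.2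
  have hmem : ∀ (t : ℝ) (z : hyper n), a + (H * t) • n + (z : Pt d) ∈ K →
      t ∈ Set.Icc (0 : ℝ) 1 ∧ ∃ z' ∈ C, (z : Pt d) = t • (z' : Pt d) := by
    intro t z h
    obtain ⟨t', ht', z', hz', h⟩ := (hK _).1 h
    rw [add_assoc, add_right_inj] at h
    have h1 := congrArg (fun v => ⟪v, n⟫) h
    simp only [inner_add_left, real_inner_smul_left, hnn, hzn] at h1
    have h2 : t = t' := by
      have : H * (t - t') = 0 := by linarith
      rcases mul_eq_zero.1 this with h | h <;> linarith
    subst h2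
    refine ⟨ht', z', hz', ?_⟩
    rw [smul_add, smul_smul, mul_comm t H, add_right_inj] at h
    exact h
  have step1 : ∫ x in K, g x = ∫ s : ℝ, ∫ z : hyper n, G (a + s • n + (z : Pt d)) := by
    rw [← integral_indicator hKc.measurableSet, ← he.integral_comp e.measurableEmbedding,
      Measure.volume_eq_prod, integral_prod]
    · simp only [hep, hG]
    · exact (he.integrable_comp_emb e.measurableEmbedding).2 hGi
  have step2 : ∫ s : ℝ, ∫ z : hyper n, G (a + s • n + (z : Pt d))
      = H * ∫ t : ℝ, ∫ z : hyper n, G (a + (H * t) • n + (z : Pt d)) := by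
    rw [Measure.integral_comp_mul_left
      (fun s : ℝ => ∫ z : hyper n, G (a + s • n + (z : Pt d))) H, abs_of_pos (inv_pos.2 hH),
      smul_eq_mul, ← mul_assoc, mul_inv_cancel₀ hH.ne', one_mul]
  have step3 : ∀ t ∈ Set.Ioc (0 : ℝ) 1, ∫ z : hyper n, G (a + (H * t) • n + (z : Pt d))
      = ∫ z in C, t ^ (d - 1) * g (a + t • (H • n + (z : Pt d))) := by
    intro t ht
    have ht0 : t ≠ 0 := ht.1.ne'
    have h1 := Measure.integral_comp_smul (volume : Measure (hyper n))
      (fun z : hyper n => G (a + (H * t) • n + (z : Pt d))) t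
    rw [finrank_hyper hn, abs_of_pos (inv_pos.2 (pow_pos ht.1 _)), smul_eq_mul] at h1
    have h2 : ∫ z : hyper n, G (a + (H * t) • n + (z : Pt d)) = t ^ (d - 1) *
        ∫ z : hyper n, G (a + (H * t) • n + ((t • z : hyper n) : Pt d)) := by
      rw [h1, ← mul_assoc, mul_inv_cancel₀ (pow_ne_zero _ ht0), one_mul]
    rw [h2, integral_const_mul]
    congr 1
    rw [← integral_indicator hC.measurableSet]
    congr 1
    ext z
    have hxz : a + (H * t) • n + ((t • z : hyper n) : Pt d) = a + t • (H • n + (z : Pt d)) := by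
      rw [Submodule.coe_smul, smul_add, smul_smul, mul_comm t H, add_assoc]
    by_cases hz : z ∈ C
    · rw [Set.indicator_of_mem hz, hG, Set.indicator_of_mem, hxz]
      rw [hxz]
      exact (hK _).2 ⟨t, ⟨ht.1.le, ht.2⟩, z, hz, rfl⟩
    · rw [Set.indicator_of_notMem hz, hG, Set.indicator_of_notMem]
      intro h
      obtain ⟨-, z', hz', h'⟩ := hmem t _ h
      rw [Submodule.coe_smul] at h'
      have : z = z' := Subtype.ext (smul_right_injective _ ht0 h')
      exact hz (this ▸ hz')
  have step4 : ∫ t : ℝ, ∫ z : hyper n, G (a + (H * t) • n + (z : Pt d))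
      = ∫ t in Set.Ioc (0 : ℝ) 1, ∫ z in C, t ^ (d - 1) * g (a + t • (H • n + (z : Pt d))) := by
    rw [← setIntegral_congr_fun measurableSet_Ioc step3, integral_Ioc_eq_integral_Ioo,
      ← integral_Icc_eq_integral_Ioo, eq_comm]
    apply setIntegral_eq_integral_of_forall_compl_eq_zero
    intro t ht
    apply integral_eq_zero_of_ae
    refine Filter.Eventually.of_forall fun z => ?_
    exact Set.indicator_of_notMem (fun h => ht (hmem t z h).1) _
  rw [step1, step2, step4]
  congr 1
  have hcont : Continuous (fun p : ℝ × hyper n =>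
      p.1 ^ (d - 1) * g (a + p.1 • (H • n + (p.2 : Pt d)))) := by fun_prop
  rw [integral_integral_swap]
  · simp only [intervalIntegral.integral_of_le zero_le_one]
  · rw [Measure.prod_restrict]
    exact (hcont.continuousOn.integrableOn_compact (isCompact_Icc.prod hC)).mono_set
      (Set.prod_mono Set.Ioc_subset_Icc_self subset_rfl)

/-- The divergence theorem for the field `φ(x) (x - a)`, radial from the apex `a` of a cone. -/
theorem integral_cone_div (hd : 0 < d) (a : Pt d) {n : Pt d} (hn : ‖n‖ = 1) {H : ℝ} (hH : 0 < H)
    {C : Set (hyper n)} (hC : IsCompact C) {K : Set (Pt d)} (hKc : IsCompact K)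
    (hK : ∀ x, x ∈ K ↔ ∃ t ∈ Set.Icc (0 : ℝ) 1, ∃ z ∈ C, x = a + t • (H • n + (z : Pt d)))
    {φ : Pt d → ℝ} (hφ : ContDiff ℝ 1 φ) :
    ∫ x in K, (d * φ x + fderiv ℝ φ x (x - a)) = H * ∫ z in C, φ (a + (H • n + (z : Pt d))) := by
  have hf : Continuous (fderiv ℝ φ) := hφ.continuous_fderiv (by simp)
  have hc : Continuous φ := hφ.continuous
  rw [integral_cone a hn hH hC hKc hK (by fun_prop)]
  congr 1
  refine integral_congr_ae (Filter.Eventually.of_forall fun z => ?_)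
  set w : Pt d := H • n + (z : Pt d)
  have hder : ∀ t : ℝ, HasDerivAt (fun t : ℝ => t ^ d * φ (a + t • w))
      (t ^ (d - 1) * (d * φ (a + t • w) + fderiv ℝ φ (a + t • w) (a + t • w - a))) t := by
    intro t
    have h1 : HasDerivAt (fun t : ℝ => a + t • w) w t := by
      simpa using ((hasDerivAt_id t).smul_const w).const_add a
    have h2 := ((hφ.differentiable (by simp)) (a + t • w)).hasFDerivAt.comp_hasDerivAt t h1
    refine ((hasDerivAt_pow d t).mul h2).congr_deriv ?_
    rw [add_sub_cancel_left, map_smul, smul_eq_mul]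
    obtain ⟨m, rfl⟩ : ∃ m, d = m + 1 := ⟨d - 1, by omega⟩
    simp only [Function.comp_apply, Nat.add_sub_cancel]
    ring
  have := intervalIntegral.integral_eq_sub_of_hasDerivAt (a := 0) (b := 1)
    (fun t _ => hder t) (by apply Continuous.intervalIntegrable; fun_prop)
  change ∫ t in (0 : ℝ)..1, t ^ (d - 1) *
    (d * φ (a + t • w) + fderiv ℝ φ (a + t • w) (a + t • w - a)) = φ (a + w)
  rw [this, one_pow, one_smul, one_mul, zero_pow hd.ne', zero_mul, sub_zero]

end Cone

section Divergence

variable {d : ℕ} {K : Finset (Pt d)} {a : Pt d}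

theorem isCompact_closedSimplex (A : Finset (Pt d)) : IsCompact (closedSimplex A) :=
  A.finite_toSet.isCompact_convexHull ℝ

theorem measurableSet_closedSimplex (A : Finset (Pt d)) : MeasurableSet (closedSimplex A) :=
  (isCompact_closedSimplex A).measurableSet

theorem IsSimplex.sub_mem_hyper (hd : 0 < d) (hK : IsSimplex K) (ha : a ∈ K) {y : Pt d}
    (hy : y ∈ closedSimplex (K.erase a)) :
    y - (a + height K a • outwardNormal K a) ∈ hyper (outwardNormal K a) := by
  rw [Submodule.mem_orthogonal_singleton_iff_inner_left, ← sub_sub, inner_sub_left,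
    hK.inner_sub_outwardNormal_of_mem_facet hd ha hy, real_inner_smul_left,
    hK.inner_outwardNormal_self hd ha, mul_one, sub_self]

/-- The parametrization of a facet by the hyperplane orthogonal to its normal. -/
theorem IsSimplex.facetMeasure_eq_map (hd : 0 < d) (hK : IsSimplex K) (ha : a ∈ K) :
    facetMeasure (K.erase a) =
      (volume.restrict ((fun z : hyper (outwardNormal K a) =>
          (a + height K a • outwardNormal K a) + (z : Pt d)) ⁻¹' closedSimplex (K.erase a))).map
        (fun z : hyper (outwardNormal K a) => (a + height K a • outwardNormal K a) + (z : Pt d)) :=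
  (map_volume_hyper _ (hK.norm_outwardNormal hd ha) _ (measurableSet_closedSimplex _)
    (fun _ hy => hK.sub_mem_hyper hd ha hy)).symm

theorem isCompact_preimage_facet (K : Finset (Pt d)) (a n c : Pt d) :
    IsCompact ((fun z : hyper n => c + (z : Pt d)) ⁻¹' closedSimplex (K.erase a)) :=
  (isometry_add_hyper n c).isClosedEmbedding.isCompact_preimage (isCompact_closedSimplex _)

theorem IsSimplex.isFiniteMeasure_facetMeasure (hd : 0 < d) (hK : IsSimplex K) (ha : a ∈ K) :
    IsFiniteMeasure (facetMeasure (K.erase a)) := by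
  rw [hK.facetMeasure_eq_map hd ha]
  have : IsFiniteMeasure ((volume : Measure (hyper (outwardNormal K a))).restrict
      ((fun z : hyper (outwardNormal K a) =>
          (a + height K a • outwardNormal K a) + (z : Pt d)) ⁻¹' closedSimplex (K.erase a))) :=
    isFiniteMeasure_restrict.2 (isCompact_preimage_facet _ _ _ _).measure_lt_top.ne
  infer_instance

theorem ae_facetMeasure_mem (F : Finset (Pt d)) : ∀ᵐ x ∂(facetMeasure F), x ∈ closedSimplex F :=
  ae_restrict_mem (measurableSet_closedSimplex F)

theorem IsSimplex.integrable_facetMeasure (hd : 0 < d) (hK : IsSimplex K) (ha : a ∈ K)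
    {g : Pt d → ℝ} (hg : Continuous g) : Integrable g (facetMeasure (K.erase a)) := by
  have := hK.isFiniteMeasure_facetMeasure hd ha
  obtain ⟨B, hB⟩ := (isCompact_closedSimplex (K.erase a)).exists_bound_of_continuousOn
    hg.continuousOn
  exact Integrable.of_bound hg.aestronglyMeasurable B ((ae_facetMeasure_mem _).mono hB)

theorem mem_closedSimplex_iff_exists_smul (hd : 0 < d) (hK : IsSimplex K) (ha : a ∈ K) (x : Pt d) :
    x ∈ closedSimplex K ↔ ∃ t ∈ Set.Icc (0 : ℝ) 1, ∃ y ∈ closedSimplex (K.erase a),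
      x = a + t • (y - a) := by
  have hne : ((K.erase a : Finset (Pt d)) : Set (Pt d)).Nonempty := by
    rw [Finset.coe_nonempty, ← Finset.card_pos, hK.card_erase ha]; exact hd
  rw [closedSimplex]
  conv_lhs => rw [← Finset.insert_erase ha]
  rw [Finset.coe_insert, convexHull_insert hne, convexJoin_singleton_left, Set.mem_iUnion₂]
  simp only [segment_eq_image', Set.mem_image]
  constructor
  · rintro ⟨y, hy, t, ht, rfl⟩
    exact ⟨t, ht, y, hy, rfl⟩
  · rintro ⟨t, ht, y, hy, rfl⟩
    exact ⟨y, hy, t, ht, rfl⟩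

/-- The divergence theorem on a simplex for a field that is radial from a vertex: it is tangential
to every facet but the opposite one, where its normal component is `H_a φ`. -/
theorem IsSimplex.integral_div_radial (hd : 0 < d) (hK : IsSimplex K) (ha : a ∈ K)
    {φ : Pt d → ℝ} (hφ : ContDiff ℝ 1 φ) :
    ∫ x in closedSimplex K, (d * φ x + fderiv ℝ φ x (x - a))
      = height K a * ∫ x, φ x ∂(facetMeasure (K.erase a)) := by
  have hi := isometry_add_hyper (outwardNormal K a) (a + height K a • outwardNormal K a)
  rw [hK.facetMeasure_eq_map hd ha, integral_map hi.continuous.aemeasurable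
    hφ.continuous.aestronglyMeasurable]
  rw [integral_cone_div hd a (hK.norm_outwardNormal hd ha) (hK.height_pos hd ha)
    (isCompact_preimage_facet K a _ (a + height K a • outwardNormal K a))
    (isCompact_closedSimplex K) _ hφ]
  · simp only [add_assoc]
  · intro x
    rw [mem_closedSimplex_iff_exists_smul hd hK ha]
    constructor
    · rintro ⟨t, ht, y, hy, rfl⟩
      refine ⟨t, ht, ⟨_, hK.sub_mem_hyper hd ha hy⟩, ?_, ?_⟩
      · rw [Set.mem_preimage]; simpa using hy
      · congr 2; simp only; abel
    · rintro ⟨t, ht, z, hz, rfl⟩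
      refine ⟨t, ht, _, hz, ?_⟩
      congr 2; simp only; abel

theorem closedSimplex_ae_eq_openCell (K : Finset (Pt d)) :
    closedSimplex K =ᵐ[volume] openCell K := by
  have h := (convex_convexHull ℝ (K : Set (Pt d))).addHaar_frontier volume
  refine (Filter.EventuallyEq.symm ?_)
  exact interior_ae_eq_of_null_frontier h

theorem setIntegral_openCell (K : Finset (Pt d)) (g : Pt d → ℝ) :
    ∫ x in openCell K, g x = ∫ x in closedSimplex K, g x :=
  setIntegral_congr_set (closedSimplex_ae_eq_openCell K).symm

theorem integrableOn_closedSimplex (K : Finset (Pt d)) {g : Pt d → ℝ} (hg : Continuous g) :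
    IntegrableOn g (closedSimplex K) :=
  hg.continuousOn.integrableOn_compact (isCompact_closedSimplex K)

/-- The divergence of `v` at `x`. -/
noncomputable def divergence (v : Pt d → Pt d) (x : Pt d) : ℝ :=
  ∑ i : Fin d, fderiv ℝ v x (EuclideanSpace.single i 1) i

/-- The trace of `A`, computed from the decomposition of the identity as the sum of the rank-one
operators `(x - b) ⊗ n_b / H_b`. -/
theorem IsSimplex.trace_eq (hd : 0 < d) (hK : IsSimplex K) (A : Pt d →L[ℝ] Pt d) (x : Pt d) :
    ∑ i : Fin d, A (EuclideanSpace.single i 1) i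
      = ∑ b ∈ K, ⟪A (x - b), outwardNormal K b⟫ / height K b := by
  have h : ∀ i : Fin d, A (EuclideanSpace.single i 1) i
      = ∑ b ∈ K, outwardNormal K b i * A (x - b) i / height K b := by
    intro i
    have h1 := (hK.sum_inner_outwardNormal_div_height hd (EuclideanSpace.single i 1)).2 x
    conv_lhs => rw [← h1]
    simp only [map_sum, map_smul, EuclideanSpace.inner_single_left, WithLp.ofLp_sum,
      Finset.sum_apply, PiLp.smul_apply, smul_eq_mul, map_one, one_mul]
    exact Finset.sum_congr rfl fun b _ => by ring
  rw [Finset.sum_congr rfl fun i _ => h i, Finset.sum_comm]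
  refine Finset.sum_congr rfl fun b _ => ?_
  rw [← Finset.sum_div, PiLp.inner_apply]
  simp

/-- The divergence theorem on a simplex: a field is the sum of the fields
`(v · n_b / H_b) (x - b)`, each of which is radial from a vertex `b` and has flux only through the
facet opposite to `b`. -/
theorem IsSimplex.integral_divergence (hd : 0 < d) (hK : IsSimplex K)
    {v : Pt d → Pt d} (hv : ContDiff ℝ 1 v) :
    ∫ x in closedSimplex K, divergence v x
      = ∑ a ∈ K, ∫ x, ⟪v x, outwardNormal K a⟫ ∂(facetMeasure (K.erase a)) := by
  have hφ : ∀ b, ContDiff ℝ 1 (fun x => ⟪v x, outwardNormal K b⟫ / height K b) := fun b =>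
    (hv.inner ℝ contDiff_const).div_const _
  have hpt : ∀ x, divergence v x = ∑ b ∈ K, (d * (⟪v x, outwardNormal K b⟫ / height K b)
      + fderiv ℝ (fun x => ⟪v x, outwardNormal K b⟫ / height K b) x (x - b)) := by
    intro x
    rw [Finset.sum_add_distrib, ← Finset.mul_sum,
      (hK.sum_inner_outwardNormal_div_height hd (v x)).1, mul_zero, zero_add, divergence,
      hK.trace_eq hd _ x]
    refine Finset.sum_congr rfl fun b _ => ?_
    have h1 := (hv.differentiable (by simp) x).hasFDerivAt
    have h2 := ((h1.inner ℝ (hasFDerivAt_const (outwardNormal K b) x)).mul_const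
      (height K b)⁻¹)
    simp only [div_eq_mul_inv]
    rw [h2.fderiv]
    simp [mul_comm]
  simp only [hpt]
  rw [integral_finsetSum]
  · refine Finset.sum_congr rfl fun b hb => ?_
    rw [hK.integral_div_radial hd hb (hφ b), integral_div,
      mul_div_cancel₀ _ (hK.height_pos hd hb).ne']
  · intro b _
    have h1 := (hφ b).continuous_fderiv (by simp)
    have h2 := (hφ b).continuous
    exact integrableOn_closedSimplex K (by fun_prop)

end Divergence

/-! ### Polynomial functions -/

section Poly

variable {d k l : ℕ} {f g : Pt d → ℝ}

theorem IsPoly.mono (hg : IsPoly k g) (h : k ≤ l) : IsPoly l g := by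
  obtain ⟨P, hP, hgP⟩ := hg
  exact ⟨P, hP.trans h, hgP⟩

theorem isPoly_const (c : ℝ) : IsPoly k (fun _ : Pt d => c) :=
  ⟨MvPolynomial.C c, by simp, by simp⟩

theorem isPoly_coord (i : Fin d) : IsPoly 1 (fun x : Pt d => x i) :=
  ⟨MvPolynomial.X i, by simp, by simp⟩

theorem IsPoly.add (hf : IsPoly k f) (hg : IsPoly k g) : IsPoly k (fun x => f x + g x) := by
  obtain ⟨P, hP, hfP⟩ := hf
  obtain ⟨Q, hQ, hgQ⟩ := hg
  exact ⟨P + Q, (MvPolynomial.totalDegree_add _ _).trans (max_le hP hQ), by simp [hfP, hgQ]⟩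

theorem IsPoly.mul (hf : IsPoly k f) (hg : IsPoly l g) : IsPoly (k + l) (fun x => f x * g x) := by
  obtain ⟨P, hP, hfP⟩ := hf
  obtain ⟨Q, hQ, hgQ⟩ := hg
  exact ⟨P * Q, (MvPolynomial.totalDegree_mul _ _).trans (add_le_add hP hQ), by simp [hfP, hgQ]⟩

theorem IsPoly.const_mul (c : ℝ) (hf : IsPoly k f) : IsPoly k (fun x => c * f x) :=
  ((isPoly_const (k := 0) c).mul hf).mono (by omega)

theorem IsPoly.pow (hf : IsPoly k f) (m : ℕ) : IsPoly (m * k) (fun x => f x ^ m) := by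
  induction m with
  | zero => simpa using isPoly_const 1
  | succ m ih => simpa only [pow_succ, Nat.succ_mul] using ih.mul hf

theorem IsPoly.sum {ι : Type*} (s : Finset ι) {f : ι → Pt d → ℝ} (hf : ∀ i ∈ s, IsPoly k (f i)) :
    IsPoly k (fun x => ∑ i ∈ s, f i x) := by
  induction s using Finset.induction_on with
  | empty => simpa using isPoly_const 0
  | insert i s hi ih =>
    simp only [Finset.sum_insert hi]
    exact (hf i (Finset.mem_insert_self i s)).add
      (ih fun j hj => hf j (Finset.mem_insert_of_mem hj))

theorem IsPoly.prod {ι : Type*} (s : Finset ι) {m : ι → ℕ} {f : ι → Pt d → ℝ}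
    (hf : ∀ i ∈ s, IsPoly (m i) (f i)) : IsPoly (∑ i ∈ s, m i) (fun x => ∏ i ∈ s, f i x) := by
  induction s using Finset.induction_on with
  | empty => simpa using isPoly_const 1
  | insert i s hi ih =>
    simp only [Finset.sum_insert hi, Finset.prod_insert hi]
    exact (hf i (Finset.mem_insert_self i s)).mul
      (ih fun j hj => hf j (Finset.mem_insert_of_mem hj))

theorem IsPoly.comp_affine (hg : IsPoly k g) (c : Pt d) (ρ : ℝ) :
    IsPoly k (fun y => g (c + ρ • y)) := by
  obtain ⟨P, hP, hgP⟩ := hg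
  have : (fun y => g (c + ρ • y)) = fun y : Pt d => ∑ s ∈ P.support,
      P.coeff s * ∏ i, (c i + ρ * y i) ^ s i := by
    ext y
    rw [hgP, MvPolynomial.eval_eq']
    simp
  rw [this]
  refine IsPoly.sum _ fun s hs => IsPoly.const_mul _ ?_
  have h1 : IsPoly (∑ i, s i * 1) (fun y : Pt d => ∏ i, (c i + ρ * y i) ^ s i) :=
    IsPoly.prod _ fun i _ => ((isPoly_const _).add ((isPoly_coord i).const_mul ρ)).pow (s i)
  refine h1.mono (le_trans ?_ hP)
  have := MvPolynomial.le_totalDegree hs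
  simpa [Finsupp.sum_fintype] using this

theorem IsPoly.analyticOnNhd (hg : IsPoly k g) : AnalyticOnNhd ℝ g Set.univ := by
  obtain ⟨P, -, hgP⟩ := hg
  have : g = fun x : Pt d => MvPolynomial.aeval (fun i => x i) P := by
    ext x; rw [hgP, MvPolynomial.aeval_eq_eval]
  rw [this]
  intro x _
  apply AnalyticAt.aeval_mvPolynomial
  intro i
  exact (EuclideanSpace.proj i : Pt d →L[ℝ] ℝ).analyticAt x

theorem IsPoly.contDiff (hg : IsPoly k g) {n : WithTop ℕ∞} : ContDiff ℝ n g :=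
  contDiffOn_univ.1 (hg.analyticOnNhd.contDiffOn uniqueDiffOn_univ)

theorem IsPoly.continuous (hg : IsPoly k g) : Continuous g := (hg.contDiff (n := 0)).continuous

/-- The space of polynomial functions of degree at most `k`. -/
noncomputable def polySpace (d k : ℕ) : Submodule ℝ (Pt d → ℝ) :=
  (MvPolynomial.restrictTotalDegree (Fin d) ℝ k).map
    (LinearMap.pi fun x : Pt d => (MvPolynomial.aeval (fun i => x i)).toLinearMap)

theorem mem_polySpace : g ∈ polySpace d k ↔ IsPoly k g := by
  simp only [polySpace, Submodule.mem_map, MvPolynomial.mem_restrictTotalDegree, IsPoly,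
    funext_iff, LinearMap.pi_apply, AlgHom.toLinearMap_apply, MvPolynomial.aeval_eq_eval]
  exact exists_congr fun P => and_congr_right fun _ => forall_congr' fun x => eq_comm

instance (d k : ℕ) : FiniteDimensional ℝ (polySpace d k) := by
  unfold polySpace; infer_instance

/-- Differentiation does not raise the degree: difference quotients stay in the finite-dimensional,
hence pointwise closed, space of polynomial functions of degree at most `k`. -/
theorem IsPoly.fderiv_apply (hg : IsPoly k g) (v : Pt d) : IsPoly k (fun x => fderiv ℝ g x v) := by
  have hclosed : IsClosed (polySpace d k : Set (Pt d → ℝ)) :=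
    Submodule.closed_of_finiteDimensional _
  rw [← mem_polySpace]
  refine hclosed.mem_of_tendsto
    (f := fun (t : ℝ) (x : Pt d) => t⁻¹ * (g (t • v + (1 : ℝ) • x) - g x))
    (b := nhdsWithin 0 {0}ᶜ) ?_ ?_
  · rw [tendsto_pi_nhds]
    intro x
    have h := ((hg.contDiff (n := 1)).differentiable (by simp) x).hasFDerivAt.hasLineDerivAt v
    have := hasDerivAt_iff_tendsto_slope_zero.1 h
    simpa [add_comm] using this
  · refine Filter.Eventually.of_forall fun t => ?_
    rw [SetLike.mem_coe, mem_polySpace]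
    refine IsPoly.const_mul _ ?_
    simpa [sub_eq_add_neg] using (hg.comp_affine (t • v) 1).add (hg.const_mul (-1))

/-- A polynomial function vanishing almost everywhere on a ball vanishes identically. -/
theorem IsPoly.eq_zero_of_ae (hg : IsPoly k g)
    (h : g =ᵐ[volume.restrict (Metric.closedBall 0 1)] 0) : g = 0 := by
  have h1 : Set.EqOn g 0 (Metric.ball (0 : Pt d) 1) :=
    Measure.eqOn_open_of_ae_eq
      (ae_mono (Measure.restrict_mono Metric.ball_subset_closedBall le_rfl) h)
      Metric.isOpen_ball hg.continuous.continuousOn continuousOn_const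
  refine hg.analyticOnNhd.eq_of_eventuallyEq (z₀ := 0) analyticOnNhd_const ?_
  exact Filter.eventuallyEq_of_mem (Metric.ball_mem_nhds _ one_pos) h1

theorem memLp_closedBall {g : Pt d → ℝ} (hg : Continuous g) :
    MemLp g 2 (volume.restrict (Metric.closedBall (0 : Pt d) 1)) := by
  obtain ⟨B, hB⟩ := (isCompact_closedBall (0 : Pt d) 1).exists_bound_of_continuousOn
    hg.continuousOn
  have : IsFiniteMeasure ((volume : Measure (Pt d)).restrict (Metric.closedBall (0 : Pt d) 1)) :=
    isFiniteMeasure_restrict.2 (isCompact_closedBall _ _).measure_lt_top.ne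
  exact MemLp.of_bound hg.aestronglyMeasurable B
    ((ae_restrict_mem Metric.isClosed_closedBall.measurableSet).mono hB)

/-- On polynomials of bounded degree the maximum on a large ball is controlled by the `L²` norm on
the unit ball, since all norms on a finite-dimensional space are equivalent. -/
theorem exists_sq_le_integral_closedBall (d k : ℕ) (R : ℝ) :
    ∃ C : ℝ, 0 ≤ C ∧ ∀ g : Pt d → ℝ, IsPoly k g → ∀ x ∈ Metric.closedBall (0 : Pt d) R,
      g x ^ 2 ≤ C * ∫ y in Metric.closedBall (0 : Pt d) 1, g y ^ 2 := by
  set μ : Measure (Pt d) := volume.restrict (Metric.closedBall (0 : Pt d) 1) with hμ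
  have hmem : ∀ g : polySpace d k, MemLp (g : Pt d → ℝ) 2 μ := fun g =>
    memLp_closedBall (mem_polySpace.1 g.2).continuous
  let T : polySpace d k →ₗ[ℝ] Lp ℝ 2 μ :=
    { toFun := fun g => (hmem g).toLp
      map_add' := fun f g => (hmem f).toLp_add (hmem g)
      map_smul' := fun c g => (hmem g).toLp_const_smul c }
  have hT : Function.Injective T := by
    rw [← LinearMap.ker_eq_bot, LinearMap.ker_eq_bot']
    intro g hg
    have h1 : (g : Pt d → ℝ) =ᵐ[μ] 0 :=
      (hmem g).coeFn_toLp.symm.trans ((Lp.eq_zero_iff_ae_eq_zero).1 hg)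
    exact Subtype.ext ((mem_polySpace.1 g.2).eq_zero_of_ae h1)
  have : CompactSpace (Metric.closedBall (0 : Pt d) R) :=
    isCompact_iff_compactSpace.1 (isCompact_closedBall _ _)
  let E : polySpace d k →ₗ[ℝ] C(Metric.closedBall (0 : Pt d) R, ℝ) :=
    { toFun := fun g => ⟨fun x => (g : Pt d → ℝ) x,
        (mem_polySpace.1 g.2).continuous.comp continuous_subtype_val⟩
      map_add' := fun f g => rfl
      map_smul' := fun c g => rfl }
  let e := LinearEquiv.ofInjective T hT
  have : FiniteDimensional ℝ (LinearMap.range T) := inferInstance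
  let L := LinearMap.toContinuousLinearMap (E ∘ₗ (e.symm : LinearMap.range T →ₗ[ℝ] polySpace d k))
  refine ⟨‖L‖ ^ 2, by positivity, fun g hg x hx => ?_⟩
  set G : polySpace d k := ⟨g, mem_polySpace.2 hg⟩
  have h1 : ‖E G‖ ≤ ‖L‖ * ‖T G‖ := by
    have h := L.le_opNorm (e G)
    have h2 : L (e G) = E G := by simp [L]
    rw [h2] at h
    exact h
  have h2 : |g x| ≤ ‖E G‖ := (E G).norm_coe_le_norm ⟨x, hx⟩
  have h3 : ‖T G‖ ^ 2 = ∫ y in Metric.closedBall (0 : Pt d) 1, g y ^ 2 := by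
    rw [← real_inner_self_eq_norm_sq, L2.inner_def]
    refine integral_congr_ae ?_
    filter_upwards [(hmem G).coeFn_toLp] with y hy
    have : (T G : Lp ℝ 2 μ) y = g y := hy
    rw [this, real_inner_self_eq_norm_sq, Real.norm_eq_abs, sq_abs]
  rw [← h3, ← mul_pow, ← sq_abs]
  exact pow_le_pow_left₀ (abs_nonneg _) (h2.trans h1) 2

theorem integral_closedBall_comp_affine (c : Pt d) {ρ : ℝ} (hρ : 0 < ρ) (f : Pt d → ℝ) :
    ∫ y in Metric.closedBall (0 : Pt d) 1, f (c + ρ • y)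
      = (ρ ^ d)⁻¹ * ∫ x in Metric.closedBall c ρ, f x := by
  have h1 := Measure.integral_comp_smul (volume : Measure (Pt d))
    (fun y => (Metric.closedBall c ρ).indicator f (c + y)) ρ
  rw [integral_add_left_eq_self (μ := (volume : Measure (Pt d)))
    ((Metric.closedBall c ρ).indicator f) c,
    finrank_euclideanSpace_fin, abs_of_pos (inv_pos.2 (pow_pos hρ _)), smul_eq_mul,
    integral_indicator Metric.isClosed_closedBall.measurableSet] at h1
  rw [← h1, ← integral_indicator Metric.isClosed_closedBall.measurableSet]
  congr 1
  ext y
  by_cases hy : y ∈ Metric.closedBall (0 : Pt d) 1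
  · rw [Set.indicator_of_mem hy, Set.indicator_of_mem]
    rw [mem_closedBall_zero_iff] at hy
    rw [mem_closedBall_iff_norm, add_sub_cancel_left, norm_smul, Real.norm_of_nonneg hρ.le]
    nlinarith
  · rw [Set.indicator_of_notMem hy, Set.indicator_of_notMem]
    rw [mem_closedBall_zero_iff] at hy
    rw [mem_closedBall_iff_norm, add_sub_cancel_left, norm_smul, Real.norm_of_nonneg hρ.le]
    nlinarith

end Poly

/-! ### The discrete trace inequality -/

section Trace

variable {d : ℕ} {K : Finset (Pt d)}

/-- The surface area of a simplex containing a ball of radius `ρ`: the outward flux of `x - c`,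
where `c` is the centre of the ball, is at least `ρ` per unit of area. -/
theorem IsSimplex.surface_le (hd : 0 < d) (hK : IsSimplex K) {c : Pt d} {ρ : ℝ} (hρ : 0 < ρ)
    (hball : Metric.closedBall c ρ ⊆ closedSimplex K) :
    ρ * ∑ a ∈ K, (facetMeasure (K.erase a)).real Set.univ
      ≤ d * volume.real (closedSimplex K) := by
  have hdiv : ∀ x, divergence (fun x : Pt d => x - c) x = d := by
    intro x
    have h : HasFDerivAt (fun x : Pt d => x - c) (ContinuousLinearMap.id ℝ (Pt d)) x :=
      (hasFDerivAt_id x).sub_const c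
    simp [divergence, h.fderiv]
  have h := hK.integral_divergence hd (v := fun x => x - c) (by fun_prop)
  simp only [hdiv, setIntegral_const, smul_eq_mul] at h
  rw [mul_comm (d : ℝ), h, Finset.mul_sum]
  refine Finset.sum_le_sum fun a ha => ?_
  have := hK.isFiniteMeasure_facetMeasure hd ha
  have hc : ρ * (facetMeasure (K.erase a)).real Set.univ = ∫ _, ρ ∂(facetMeasure (K.erase a)) := by
    rw [integral_const, smul_eq_mul, mul_comm]
  rw [hc]
  refine integral_mono_ae (integrable_const _)
    (hK.integrable_facetMeasure hd ha (by fun_prop)) ?_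
  filter_upwards [ae_facetMeasure_mem (K.erase a)] with x hx
  have h1 := hK.inner_sub_outwardNormal_of_mem_facet hd ha hx
  have h2 := hK.inner_sub_outwardNormal_le hd ha (y := c + ρ • outwardNormal K a) (hball (by
    rw [mem_closedBall_iff_norm, add_sub_cancel_left, norm_smul, hK.norm_outwardNormal hd ha,
      mul_one, Real.norm_of_nonneg hρ.le]))
  rw [inner_sub_left, inner_add_left, real_inner_smul_left, hK.inner_outwardNormal_self hd ha] at h2
  rw [inner_sub_left] at h1 ⊢
  linarith

theorem exists_trace_inequality (hd : 0 < d) (k : ℕ) {σ : ℝ} (hσ : 0 < σ) :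
    ∃ C : ℝ, 0 ≤ C ∧ ∀ (K : Finset (Pt d)) (c : Pt d) (ρ : ℝ), IsSimplex K → 0 < ρ →
      Metric.closedBall c ρ ⊆ closedSimplex K → Metric.diam (closedSimplex K) ≤ σ * ρ →
      ∀ g : Pt d → ℝ, IsPoly k g →
        ρ * ∑ a ∈ K, ∫ x, g x ^ 2 ∂(facetMeasure (K.erase a))
          ≤ C * ∫ x in closedSimplex K, g x ^ 2 := by
  obtain ⟨C, hC, hsup⟩ := exists_sq_le_integral_closedBall d k σ
  set ω : ℝ := volume.real (Metric.ball (0 : Pt d) 1) with hω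
  have hω0 : 0 ≤ ω := measureReal_nonneg
  refine ⟨C * (d * (σ ^ d * ω)), by positivity, fun K c ρ hK hρ hball hdiam g hg => ?_⟩
  have hbdd : Bornology.IsBounded (closedSimplex K) := (isCompact_closedSimplex K).isBounded
  have hsub : closedSimplex K ⊆ Metric.closedBall c (σ * ρ) := fun x hx =>
    (Metric.dist_le_diam_of_mem hbdd hx (hball (Metric.mem_closedBall_self hρ.le))).trans hdiam
  set I : ℝ := ∫ x in closedSimplex K, g x ^ 2 with hI
  have hI0 : 0 ≤ I := integral_nonneg fun x => sq_nonneg _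
  have hgc := hg.continuous
  -- the maximum of `g ^ 2` on the simplex, by scaling the inscribed ball to the unit ball
  have hmax : ∀ x ∈ closedSimplex K, g x ^ 2 ≤ C * ((ρ ^ d)⁻¹ * I) := by
    intro x hx
    have h1 := hsup _ (hg.comp_affine c ρ) (ρ⁻¹ • (x - c)) (by
      have := hsub hx
      rw [mem_closedBall_iff_norm] at this
      rw [mem_closedBall_zero_iff, norm_smul, norm_inv, Real.norm_of_nonneg hρ.le,
        inv_mul_le_iff₀ hρ]
      linarith)
    rw [smul_smul, mul_inv_cancel₀ hρ.ne', one_smul, add_sub_cancel,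
      integral_closedBall_comp_affine c hρ (fun x => g x ^ 2)] at h1
    refine h1.trans ?_
    gcongr
    exact setIntegral_mono_set (integrableOn_closedSimplex K (by fun_prop))
      (Filter.Eventually.of_forall fun x => sq_nonneg _) hball.eventuallyLE
  have hvol : volume.real (closedSimplex K) ≤ (σ * ρ) ^ d * ω := by
    have := measureReal_mono (μ := volume) hsub (isCompact_closedBall _ _).measure_lt_top.ne
    rwa [Measure.addHaar_real_closedBall _ _ (by positivity), finrank_euclideanSpace_fin] at this
  have hsurf := hK.surface_le hd hρ hball
  have hle : ∑ a ∈ K, ∫ x, g x ^ 2 ∂(facetMeasure (K.erase a))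
      ≤ C * ((ρ ^ d)⁻¹ * I) * ∑ a ∈ K, (facetMeasure (K.erase a)).real Set.univ := by
    rw [Finset.mul_sum]
    refine Finset.sum_le_sum fun a ha => ?_
    have := hK.isFiniteMeasure_facetMeasure hd ha
    have hc : C * ((ρ ^ d)⁻¹ * I) * (facetMeasure (K.erase a)).real Set.univ
        = ∫ _, C * ((ρ ^ d)⁻¹ * I) ∂(facetMeasure (K.erase a)) := by
      rw [integral_const, smul_eq_mul, mul_comm]
    rw [hc]
    refine integral_mono_ae (hK.integrable_facetMeasure hd ha (by fun_prop)) (integrable_const _) ?_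
    filter_upwards [ae_facetMeasure_mem (K.erase a)] with x hx
    exact hmax x (convexHull_mono (Finset.coe_subset.2 (Finset.erase_subset a K)) hx)
  calc ρ * ∑ a ∈ K, ∫ x, g x ^ 2 ∂(facetMeasure (K.erase a))
      ≤ ρ * (C * ((ρ ^ d)⁻¹ * I) * ∑ a ∈ K, (facetMeasure (K.erase a)).real Set.univ) := by gcongr
    _ = C * ((ρ ^ d)⁻¹ * I) * (ρ * ∑ a ∈ K, (facetMeasure (K.erase a)).real Set.univ) := by ring
    _ ≤ C * ((ρ ^ d)⁻¹ * I) * (d * ((σ * ρ) ^ d * ω)) := by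
        refine mul_le_mul_of_nonneg_left (hsurf.trans ?_) (by positivity)
        gcongr
    _ = C * (d * (σ ^ d * ω)) * I := by
        rw [mul_pow]; field_simp

variable {S : Scheme d} {σ : ℝ} {a : Pt d}

theorem IsSimplex.diam_pos (hd : 0 < d) (hK : IsSimplex K) :
    0 < Metric.diam (closedSimplex K) := by
  obtain ⟨a, ha, b, hb, hab⟩ := Finset.one_lt_card.1 (by rw [hK.1]; omega : 1 < K.card)
  exact (dist_pos.2 hab).trans_le (Metric.dist_le_diam_of_mem
    (isCompact_closedSimplex K).isBounded (subset_convexHull ℝ _ ha) (subset_convexHull ℝ _ hb))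

theorem Mesh.Regular.size_pos {M : Mesh d} {h : Finset (Pt d) → ℝ} (hd : 0 < d) (hσ : 0 < σ)
    (hM : M.Regular h σ) (hK : K ∈ M.cells) : 0 < h K :=
  (mul_pos (inv_pos.2 hσ) ((M.isSimplex hK).diam_pos hd)).trans_le (hM.1 K hK).1

theorem Mesh.mem_adjacent_erase {M : Mesh d} (hK : K ∈ M.cells) : K ∈ M.adjacent (K.erase a) :=
  Finset.mem_filter.2 ⟨hK, Finset.erase_subset a K⟩

theorem Scheme.facetSize_pos (hd : 0 < d) (hσ : 0 < σ) (hM : S.mesh.Regular S.cellSize σ)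
    (hK : K ∈ S.mesh.cells) : 0 < S.facetSize (K.erase a) := by
  have hmem := Mesh.mem_adjacent_erase (a := a) hK
  refine div_pos (Finset.sum_pos (fun L hL => hM.size_pos hd hσ (Finset.mem_filter.1 hL).1)
    ⟨K, hmem⟩) ?_
  exact_mod_cast Finset.card_pos.2 ⟨K, hmem⟩

theorem Scheme.facetSize_le (hd : 0 < d) (hσ : 0 < σ) (hM : S.mesh.Regular S.cellSize σ)
    (hK : K ∈ S.mesh.cells) (ha : a ∈ K) :
    S.facetSize (K.erase a) ≤ max 1 σ * S.cellSize K := by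
  have hmem := Mesh.mem_adjacent_erase (a := a) hK
  have hpos := hM.size_pos hd hσ hK
  rw [Scheme.facetSize, div_le_iff₀ (by exact_mod_cast Finset.card_pos.2 ⟨K, hmem⟩), mul_comm,
    ← nsmul_eq_mul]
  refine Finset.sum_le_card_nsmul _ _ _ fun L hL => ?_
  obtain ⟨hL, hFL⟩ := Finset.mem_filter.1 hL
  by_cases hKL : K = L
  · subst hKL
    exact le_mul_of_one_le_left hpos.le (le_max_left _ _)
  · have hcard : (L ∩ K).card = d := by
      rw [Finset.inter_comm, (S.mesh.isSimplex hK).inter_eq_erase (S.mesh.isSimplex hL) ha hFL hKL,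
        (S.mesh.isSimplex hK).card_erase ha]
    exact (hM.2.2 L hL K hK hcard).trans (by gcongr; exact le_max_right _ _)

/-- The trace inequality on the cells of a regular triangulation, weighted by the facet sizes. -/
theorem exists_weighted_trace_inequality (hd : 0 < d) (k : ℕ) (hσ : 0 < σ) :
    ∃ C : ℝ, 0 ≤ C ∧ ∀ S : Scheme d, S.mesh.Regular S.cellSize σ → ∀ K ∈ S.mesh.cells,
      ∀ g : Pt d → ℝ, IsPoly k g →
        ∑ a ∈ K, S.facetSize (K.erase a) * ∫ x, g x ^ 2 ∂(facetMeasure (K.erase a))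
          ≤ C * ∫ x in closedSimplex K, g x ^ 2 := by
  obtain ⟨C, hC, htr⟩ := exists_trace_inequality hd k hσ
  refine ⟨max 1 σ * σ ^ 2 * C, by positivity, fun S hM K hK g hg => ?_⟩
  have sK := S.mesh.isSimplex hK
  obtain ⟨c, hc⟩ := hM.2.1 K hK
  set D := Metric.diam (closedSimplex K) with hD
  have hD0 : 0 < D := sK.diam_pos hd
  have h1 := htr K c (σ⁻¹ * D) sK (by positivity) hc
    (by rw [← mul_assoc, mul_inv_cancel₀ hσ.ne', one_mul]) g hg
  have hsize : ∀ a ∈ K, S.facetSize (K.erase a) ≤ max 1 σ * σ ^ 2 * (σ⁻¹ * D) := by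
    intro a ha
    calc S.facetSize (K.erase a) ≤ max 1 σ * S.cellSize K := S.facetSize_le hd hσ hM hK ha
      _ ≤ max 1 σ * (σ * D) := by gcongr; exact (hM.1 K hK).2
      _ = _ := by field_simp
  calc ∑ a ∈ K, S.facetSize (K.erase a) * ∫ x, g x ^ 2 ∂(facetMeasure (K.erase a))
      ≤ ∑ a ∈ K, max 1 σ * σ ^ 2 * (σ⁻¹ * D) * ∫ x, g x ^ 2 ∂(facetMeasure (K.erase a)) :=
        Finset.sum_le_sum fun a ha => mul_le_mul_of_nonneg_right (hsize a ha)
          (integral_nonneg fun x => sq_nonneg _)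
    _ = max 1 σ * σ ^ 2 *
          (σ⁻¹ * D * ∑ a ∈ K, ∫ x, g x ^ 2 ∂(facetMeasure (K.erase a))) := by
        rw [← Finset.mul_sum, mul_assoc]
    _ ≤ max 1 σ * σ ^ 2 * (C * ∫ x in closedSimplex K, g x ^ 2) := by gcongr
    _ = _ := by ring

end Trace

/-! ### Sums over cells, boundaries and facets -/

namespace Mesh

variable {d : ℕ} {M : Mesh d}

theorem erase_mem_facets {K : Finset (Pt d)} {a : Pt d} (hK : K ∈ M.cells) (ha : a ∈ K) :
    K.erase a ∈ M.facets :=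
  ⟨(M.isSimplex hK).card_erase ha, K, hK, Finset.erase_subset a K⟩

/-- The integrand of `Σ_K ∫_K` is continuous on every cell. -/
def ContCells (M : Mesh d) (g : Finset (Pt d) → Pt d → ℝ) : Prop :=
  ∀ K ∈ M.cells, Continuous (g K)

/-- The integrand of `Σ_K ∫_{∂K}` is continuous on every facet of every cell. -/
def ContBoundaries (M : Mesh d) (g : Finset (Pt d) → Finset (Pt d) → Pt d → Pt d → ℝ) : Prop :=
  ∀ K ∈ M.cells, ∀ a ∈ K, Continuous (g K (K.erase a) (outwardNormal K a))

theorem integrableOn_openCell (K : Finset (Pt d)) {g : Pt d → ℝ} (hg : Continuous g) :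
    IntegrableOn g (openCell K) :=
  (integrableOn_closedSimplex K hg).mono_set interior_subset

section Cells

variable {f g : Finset (Pt d) → Pt d → ℝ}

theorem sumCells_congr (h : ∀ K ∈ M.cells, ∀ x, f K x = g K x) : M.sumCells f = M.sumCells g :=
  Finset.sum_congr rfl fun K hK => by simp only [h K hK]

theorem sumCells_add (hf : M.ContCells f) (hg : M.ContCells g) :
    M.sumCells (fun K x => f K x + g K x) = M.sumCells f + M.sumCells g := by
  rw [sumCells, sumCells, sumCells, ← Finset.sum_add_distrib]
  exact Finset.sum_congr rfl fun K hK =>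
    integral_add (integrableOn_openCell K (hf K hK)) (integrableOn_openCell K (hg K hK))

theorem sumCells_const_mul (c : ℝ) (f : Finset (Pt d) → Pt d → ℝ) :
    M.sumCells (fun K x => c * f K x) = c * M.sumCells f := by
  simp only [sumCells, integral_const_mul, Finset.mul_sum]

end Cells

section Boundaries

variable {f g : Finset (Pt d) → Finset (Pt d) → Pt d → Pt d → ℝ}

theorem sumBoundaries_congr (h : ∀ K ∈ M.cells, ∀ a ∈ K, ∀ x,
    f K (K.erase a) (outwardNormal K a) x = g K (K.erase a) (outwardNormal K a) x) :
    M.sumBoundaries f = M.sumBoundaries g :=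
  Finset.sum_congr rfl fun K hK => Finset.sum_congr rfl fun a ha => by simp only [h K hK a ha]

theorem sumBoundaries_add (hd : 0 < d) (hf : M.ContBoundaries f) (hg : M.ContBoundaries g) :
    M.sumBoundaries (fun K F n x => f K F n x + g K F n x)
      = M.sumBoundaries f + M.sumBoundaries g := by
  rw [sumBoundaries, sumBoundaries, sumBoundaries, ← Finset.sum_add_distrib]
  refine Finset.sum_congr rfl fun K hK => ?_
  rw [← Finset.sum_add_distrib]
  exact Finset.sum_congr rfl fun a ha => integral_add
    ((M.isSimplex hK).integrable_facetMeasure hd ha (hf K hK a ha))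
    ((M.isSimplex hK).integrable_facetMeasure hd ha (hg K hK a ha))

theorem sumBoundaries_const_mul (c : ℝ)
    (f : Finset (Pt d) → Finset (Pt d) → Pt d → Pt d → ℝ) :
    M.sumBoundaries (fun K F n x => c * f K F n x) = c * M.sumBoundaries f := by
  simp only [sumBoundaries, integral_const_mul, Finset.mul_sum]

theorem sumBoundaries_mono (hd : 0 < d) (hf : M.ContBoundaries f) (hg : M.ContBoundaries g)
    (h : ∀ K ∈ M.cells, ∀ a ∈ K, ∀ x,
      f K (K.erase a) (outwardNormal K a) x ≤ g K (K.erase a) (outwardNormal K a) x) :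
    M.sumBoundaries f ≤ M.sumBoundaries g :=
  Finset.sum_le_sum fun K hK => Finset.sum_le_sum fun a ha => integral_mono
    ((M.isSimplex hK).integrable_facetMeasure hd ha (hf K hK a ha))
    ((M.isSimplex hK).integrable_facetMeasure hd ha (hg K hK a ha)) (h K hK a ha)

theorem sumBoundaries_nonneg (h : ∀ K ∈ M.cells, ∀ a ∈ K, ∀ x,
    0 ≤ f K (K.erase a) (outwardNormal K a) x) : 0 ≤ M.sumBoundaries f :=
  Finset.sum_nonneg fun K hK => Finset.sum_nonneg fun a ha => integral_nonneg (h K hK a ha)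

/-- The flux of a single-valued field through the interior facets cancels, so that the total flux
out of all cells vanishes if the field vanishes on the exterior facets. -/
theorem sumBoundaries_inner_eq_zero (hd : 0 < d) (φ : Finset (Pt d) → Pt d → Pt d)
    (hφ : ∀ F ∈ M.exteriorFacets, ∀ x ∈ closedSimplex F, φ F x = 0) :
    M.sumBoundaries (fun _ F n x => ⟪φ F x, n⟫) = 0 := by
  set I : (Σ _ : Finset (Pt d), Pt d) → ℝ := fun z =>
    ∫ x, ⟪φ (z.1.erase z.2) x, outwardNormal z.1 z.2⟫ ∂(facetMeasure (z.1.erase z.2)) with hI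
  have h1 : M.sumBoundaries (fun _ F n x => ⟪φ F x, n⟫)
      = ∑ z ∈ M.cells.sigma (fun K => K), I z := by
    rw [Finset.sum_sigma]; rfl
  rw [h1, ← Finset.sum_fiberwise_of_maps_to
    (t := (M.cells.sigma (fun K => K)).image fun z => z.1.erase z.2)
    (g := fun z => z.1.erase z.2) (fun z hz => Finset.mem_image_of_mem _ hz)]
  refine Finset.sum_eq_zero fun F hF => ?_
  obtain ⟨⟨K, a⟩, hz, hzF⟩ := Finset.mem_image.1 hF
  obtain ⟨hK, ha⟩ := Finset.mem_sigma.1 hz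
  simp only at hK ha hzF
  set T := (M.cells.sigma (fun K => K)).filter fun z => z.1.erase z.2 = F with hT
  have memT : ∀ L b, (⟨L, b⟩ : Σ _ : Finset (Pt d), Pt d) ∈ T ↔
      L ∈ M.cells ∧ b ∈ L ∧ L.erase b = F := by
    intro L b
    rw [hT, Finset.mem_filter, Finset.mem_sigma, and_assoc]
  have hKT : (⟨K, a⟩ : Σ _ : Finset (Pt d), Pt d) ∈ T := (memT K a).2 ⟨hK, ha, hzF⟩
  have hcard : F.card = d := hzF ▸ (M.isSimplex hK).card_erase ha
  -- a cell determines the vertex opposite to `F`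
  have huniq : ∀ (L : Finset (Pt d)) (b c : Pt d), b ∈ L → c ∈ L →
      L.erase b = F → L.erase c = F → b = c := by
    intro L b c hb hc h1 h2
    by_contra hne
    have : c ∈ L.erase b := Finset.mem_erase.2 ⟨Ne.symm hne, hc⟩
    rw [h1, ← h2] at this
    exact Finset.notMem_erase c L this
  by_cases hex : ∃ L ∈ M.cells, F ⊆ L ∧ L ≠ K
  · obtain ⟨L, hL, hFL, hne⟩ := hex
    obtain ⟨b, hb, hbF⟩ := (M.isSimplex hL).exists_erase_eq hcard hFL
    have hLT := (memT L b).2 ⟨hL, hb, hbF⟩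
    have hKL := M.outwardNormal_eq_neg hd hK hL ha hb (hzF.trans hbF.symm) hne.symm
    have hTeq : T = {⟨K, a⟩, ⟨L, b⟩} := by
      ext ⟨N, c⟩
      rw [Finset.mem_insert, Finset.mem_singleton]
      constructor
      · intro h
        obtain ⟨hN, hc, hcF⟩ := (memT N c).1 h
        by_cases hNK : N = K
        · subst hNK
          left; rw [huniq N c a hc ha hcF hzF]
        by_cases hNL : N = L
        · subst hNL
          right; rw [huniq N c b hc hb hcF hbF]
        -- three cells cannot lie pairwise on opposite sides of one facet
        exfalso
        have e1 := M.outwardNormal_eq_neg hd hK hN ha hc (hzF.trans hcF.symm) (Ne.symm hNK)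
        have e2 := M.outwardNormal_eq_neg hd hL hN hb hc (hbF.trans hcF.symm) (Ne.symm hNL)
        rw [hKL, neg_neg, e1] at e2
        have h0 : outwardNormal K a = 0 := by
          have h2 : (2 : ℝ) • outwardNormal K a = 0 := by
            rw [two_smul]; nth_rewrite 1 [← e2]; exact neg_add_cancel _
          exact (smul_eq_zero.1 h2).resolve_left two_ne_zero
        have := (M.isSimplex hK).norm_outwardNormal hd ha
        rw [h0, norm_zero] at this
        exact zero_ne_one this
      · rintro (h | h) <;> rw [h] <;> assumption
    rw [hTeq, Finset.sum_pair (fun h => hne (congrArg Sigma.fst h).symm)]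
    simp only [hI, hzF, hbF, hKL, inner_neg_right, integral_neg, add_neg_cancel]
  · push Not at hex
    have hext : F ∈ M.exteriorFacets := by
      refine ⟨hzF ▸ erase_mem_facets hK ha, Finset.card_eq_one.2 ⟨K, ?_⟩⟩
      ext L
      rw [adjacent, Finset.mem_filter, Finset.mem_singleton]
      constructor
      · rintro ⟨hL, hFL⟩
        exact hex L hL hFL
      · rintro rfl
        exact ⟨hK, hzF ▸ Finset.erase_subset _ _⟩
    refine Finset.sum_eq_zero fun z hz => ?_
    obtain ⟨-, -, hzF'⟩ := (memT z.1 z.2).1 hz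
    simp only [hI, hzF']
    refine integral_eq_zero_of_ae ?_
    filter_upwards [ae_facetMeasure_mem F] with x hx
    rw [hφ F hext x hx, inner_zero_left]; rfl

end Boundaries

theorem integralOn_eq_zero {Γ : Set (Finset (Pt d))}
    {g : Finset (Pt d) → Finset (Pt d) → Pt d → Pt d → ℝ}
    (h : ∀ K, ∀ F ∈ Γ, ∀ n, ∀ x ∈ closedSimplex F, g K F n x = 0) : M.integralOn Γ g = 0 := by
  refine Finset.sum_eq_zero fun K _ => Finset.sum_eq_zero fun a ha => ?_
  refine integral_eq_zero_of_ae ?_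
  filter_upwards [ae_facetMeasure_mem (K.erase a)] with x hx
  exact h K _ (Finset.mem_filter.1 ha).2 _ x hx

theorem sumBoundaries_zero (M : Mesh d) : M.sumBoundaries (fun _ _ _ _ => 0) = 0 := by
  simp [Mesh.sumBoundaries]

theorem sumCells_zero (M : Mesh d) : M.sumCells (fun _ _ => 0) = 0 := by
  simp [Mesh.sumCells]

theorem integralOn_zero (M : Mesh d) (Γ : Set (Finset (Pt d))) :
    M.integralOn Γ (fun _ _ _ _ => 0) = 0 := by
  simp [Mesh.integralOn]

end Mesh

/-! ### The finite element spaces -/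

section Spaces

variable {d : ℕ} {S : Scheme d}

/-- The four components of `U`, each multiplied by a constant. -/
def Fields.scale (a b c e : ℝ) (U : Fields d) : Fields d where
  u K x := a • U.u K x
  ubar F x := b • U.ubar F x
  p K x := c * U.p K x
  pbar F x := e * U.pbar F x

namespace Scheme.InSpace

variable {U U' : Fields d}

theorem mid (hU : S.InSpace U) (hU' : S.InSpace U') (θ : ℝ) : S.InSpace (Fields.mid θ U U') := by
  obtain ⟨h1, h2, h3, h4, h5, h6⟩ := hU
  obtain ⟨h1', h2', h3', h4', h5', h6'⟩ := hU'
  refine ⟨fun K hK i => ((h1 K hK i).const_mul (1 - θ)).add ((h1' K hK i).const_mul θ),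
    fun F hF i => ((h2 F hF i).const_mul (1 - θ)).add ((h2' F hF i).const_mul θ),
    fun F hF x hx => ?_,
    fun K hK => ((h4 K hK).const_mul (1 - θ)).add ((h4' K hK).const_mul θ),
    fun F hF => ((h5 F hF).const_mul (1 - θ)).add ((h5' F hF).const_mul θ),
    fun hc => ⟨fun F hF G hG x hx => ?_, fun F hF G hG x hx => ?_⟩⟩
  · simp only [Fields.mid, h3 F hF x hx, h3' F hF x hx, smul_zero, add_zero]
  · simp only [Fields.mid, (h6 hc).1 F hF G hG x hx, (h6' hc).1 F hF G hG x hx]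
  · simp only [Fields.mid, (h6 hc).2 F hF G hG x hx, (h6' hc).2 F hF G hG x hx]

theorem scale (hU : S.InSpace U) (a b c e : ℝ) : S.InSpace (Fields.scale a b c e U) := by
  obtain ⟨h1, h2, h3, h4, h5, h6⟩ := hU
  refine ⟨fun K hK i => (h1 K hK i).const_mul a, fun F hF i => (h2 F hF i).const_mul b,
    fun F hF x hx => ?_, fun K hK => (h4 K hK).const_mul c, fun F hF => (h5 F hF).const_mul e,
    fun hc => ⟨fun F hF G hG x hx => ?_, fun F hF G hG x hx => ?_⟩⟩
  · simp only [Fields.scale, h3 F hF x hx, smul_zero]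
  · simp only [Fields.scale, (h6 hc).1 F hF G hG x hx]
  · simp only [Fields.scale, (h6 hc).2 F hF G hG x hx]

theorem contDiff_u (hU : S.InSpace U) {K : Finset (Pt d)} (hK : K ∈ S.mesh.cells)
    {n : WithTop ℕ∞} : ContDiff ℝ n (U.u K) :=
  (contDiff_piLp 2).2 fun i => (hU.1 K hK i).contDiff

theorem continuous_u (hU : S.InSpace U) {K : Finset (Pt d)} (hK : K ∈ S.mesh.cells) :
    Continuous (U.u K) :=
  (hU.contDiff_u hK (n := 0)).continuous

theorem continuous_ubar (hU : S.InSpace U) {K : Finset (Pt d)} (hK : K ∈ S.mesh.cells) {a : Pt d}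
    (ha : a ∈ K) : Continuous (U.ubar (K.erase a)) :=
  ((contDiff_piLp 2 (n := 0)).2 fun i =>
    (hU.2.1 _ (Mesh.erase_mem_facets hK ha) i).contDiff).continuous

theorem contDiff_p (hU : S.InSpace U) {K : Finset (Pt d)} (hK : K ∈ S.mesh.cells)
    {n : WithTop ℕ∞} : ContDiff ℝ n (U.p K) :=
  (hU.2.2.2.1 K hK).contDiff

theorem continuous_p (hU : S.InSpace U) {K : Finset (Pt d)} (hK : K ∈ S.mesh.cells) :
    Continuous (U.p K) :=
  (hU.2.2.2.1 K hK).continuous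

theorem continuous_pbar (hU : S.InSpace U) {K : Finset (Pt d)} (hK : K ∈ S.mesh.cells) {a : Pt d}
    (ha : a ∈ K) : Continuous (U.pbar (K.erase a)) :=
  (hU.2.2.2.2.1 _ (Mesh.erase_mem_facets hK ha)).continuous

theorem continuous_uhat (hU : S.InSpace U) {K : Finset (Pt d)} (hK : K ∈ S.mesh.cells) {a : Pt d}
    (ha : a ∈ K) (n : Pt d) : Continuous (S.uhat U K (K.erase a) n) := by
  have h1 := hU.continuous_u hK
  have h2 := hU.continuous_p hK
  have h3 := hU.continuous_pbar hK ha
  unfold Scheme.uhat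
  fun_prop

end Scheme.InSpace

end Spaces

/-! ### The continuity equations and the pressure -/

namespace Scheme

variable {d : ℕ} {S : Scheme d} {U U' V W : Fields d} {τ : Step d}

theorem inner_uhat_outwardNormal (hd : 0 < d) (S : Scheme d) (U : Fields d) {K : Finset (Pt d)}
    (hK : K ∈ S.mesh.cells) {a : Pt d} (ha : a ∈ K) (F : Finset (Pt d)) (x : Pt d) :
    ⟪S.uhat U K F (outwardNormal K a) x, outwardNormal K a⟫
      = ⟪U.u K x, outwardNormal K a⟫
        - S.β * S.facetSize F / (S.ν + 1) * (U.pbar F x - U.p K x) := by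
  rw [uhat, inner_sub_left, real_inner_smul_left,
    (S.mesh.isSimplex hK).inner_outwardNormal_self hd ha, mul_one]

theorem uhat_mid (S : Scheme d) (θ : ℝ) (U U' : Fields d) (K F : Finset (Pt d)) (n x : Pt d) :
    S.uhat (Fields.mid θ U U') K F n x
      = (1 - θ) • S.uhat U K F n x + θ • S.uhat U' K F n x := by
  simp only [uhat, Fields.mid]
  module

theorem Fm_zero (S : Scheme d) (τ : Step d) (U U' : Fields d) :
    S.Fm τ U U' (fun _ _ => 0) = 0 := by
  have h1 : ∀ x, symGrad (fun _ : Pt d => (0 : Pt d)) x = 0 := by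
    intro x
    rw [symGrad, fderiv_fun_const, Pi.zero_apply, map_zero, add_zero]
    ext v i
    simp
  simp [Fm, Mesh.glue, contract, h1, Mesh.sumBoundaries_zero, Mesh.sumCells_zero]

theorem Fmbar_zero (S : Scheme d) (τ : Step d) (U U' : Fields d) :
    S.Fmbar τ U U' (fun _ _ => 0) = 0 := by
  simp [Fmbar, Mesh.sumBoundaries_zero, Mesh.integralOn_zero]

theorem Fc_zero (S : Scheme d) (U : Fields d) : S.Fc U (fun _ _ => 0) = 0 := by
  have h1 : ∀ x, gradient (fun _ : Pt d => (0 : ℝ)) x = 0 := by intro x; simp [gradient]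
  simp [Fc, h1, Mesh.sumBoundaries_zero, Mesh.sumCells_zero]

theorem Fcbar_zero (S : Scheme d) (U : Fields d) : S.Fcbar U (fun _ _ => 0) = 0 := by
  simp [Fcbar, Mesh.sumBoundaries_zero, Mesh.integralOn_zero]

/-- A solution satisfies the local and the global continuity equation separately. -/
theorem Solves.continuity (h : S.Solves τ U U') (hW : S.InSpace W) :
    S.Fc U' W.p = 0 ∧ S.Fcbar U' W.pbar = 0 := by
  have h1 := h.2.2.2 _ (hW.scale 0 0 1 0)
  have h2 := h.2.2.2 _ (hW.scale 0 0 0 1)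
  simp only [Ftotal, Fields.scale, zero_smul, one_mul, zero_mul, Fm_zero, Fmbar_zero, Fc_zero,
    Fcbar_zero, zero_add, add_zero] at h1 h2
  exact ⟨h1, h2⟩

/-- The momentum equation tested with `(u, -ū)`. -/
theorem Solves.momentum (h : S.Solves τ U U') (hW : S.InSpace W) :
    S.Fm τ U U' W.u + S.Fmbar τ U U' (fun F x => -W.ubar F x) = 0 := by
  have h1 := h.2.2.2 _ (hW.scale 1 (-1) 0 0)
  simpa only [Ftotal, Fields.scale, one_smul, neg_smul, zero_mul, Fc_zero, Fcbar_zero,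
    add_zero] using h1

theorem continuous_inner_gradient (hU : S.InSpace U) (hW : S.InSpace W) {K : Finset (Pt d)}
    (hK : K ∈ S.mesh.cells) : Continuous (fun x => ⟪U.u K x, gradient (W.p K) x⟫) := by
  have h1 := hU.continuous_u hK
  have h2 : Continuous (gradient (W.p K)) :=
    (LinearIsometryEquiv.continuous _).comp
      ((hW.contDiff_p hK (n := 1)).continuous_fderiv (by simp))
  fun_prop

theorem Fc_mid (hd : 0 < d) (hU : S.InSpace U) (hU' : S.InSpace U') (hW : S.InSpace W) (θ : ℝ) :
    S.Fc (Fields.mid θ U U') W.p = (1 - θ) * S.Fc U W.p + θ * S.Fc U' W.p := by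
  have c1 : S.mesh.ContCells (fun K x => (1 - θ) * ⟪U.u K x, gradient (W.p K) x⟫) :=
    fun K hK => (continuous_inner_gradient hU hW hK).const_mul _
  have c2 : S.mesh.ContCells (fun K x => θ * ⟪U'.u K x, gradient (W.p K) x⟫) :=
    fun K hK => (continuous_inner_gradient hU' hW hK).const_mul _
  have b : ∀ (c : ℝ) (V : Fields d), S.InSpace V →
      S.mesh.ContBoundaries (fun K F n x => c * (⟪S.uhat V K F n x, n⟫ * W.p K x)) := by
    intro c V hV K hK a ha
    have h1 := hV.continuous_uhat hK ha (outwardNormal K a)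
    have h2 := hW.continuous_p hK
    fun_prop
  have e1 : S.mesh.sumCells (fun K x => ⟪(Fields.mid θ U U').u K x, gradient (W.p K) x⟫)
      = (1 - θ) * S.mesh.sumCells (fun K x => ⟪U.u K x, gradient (W.p K) x⟫)
        + θ * S.mesh.sumCells (fun K x => ⟪U'.u K x, gradient (W.p K) x⟫) := by
    rw [← Mesh.sumCells_const_mul, ← Mesh.sumCells_const_mul, ← Mesh.sumCells_add c1 c2]
    refine Mesh.sumCells_congr fun K _ x => ?_
    simp only [Fields.mid, inner_add_left, real_inner_smul_left]
  have e2 : S.mesh.sumBoundaries (fun K F n x => ⟪S.uhat (Fields.mid θ U U') K F n x, n⟫ * W.p K x)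
      = (1 - θ) * S.mesh.sumBoundaries (fun K F n x => ⟪S.uhat U K F n x, n⟫ * W.p K x)
        + θ * S.mesh.sumBoundaries (fun K F n x => ⟪S.uhat U' K F n x, n⟫ * W.p K x) := by
    rw [← Mesh.sumBoundaries_const_mul, ← Mesh.sumBoundaries_const_mul,
      ← Mesh.sumBoundaries_add hd (b _ _ hU) (b _ _ hU')]
    refine Mesh.sumBoundaries_congr fun K _ a _ x => ?_
    rw [uhat_mid, inner_add_left, real_inner_smul_left, real_inner_smul_left]
    ring
  rw [Fc, Fc, Fc, e1, e2]
  ring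

/-- The exterior part of the global continuity functional vanishes if there is no Neumann
boundary. -/
theorem InSpace.Fcbar_eq (hV : S.InSpace V) (hD : S.ΓD = S.mesh.exteriorFacets)
    (q : Finset (Pt d) → Pt d → ℝ) :
    S.Fcbar V q = S.mesh.sumBoundaries (fun K F n x => ⟪S.uhat V K F n x, n⟫ * q F x) := by
  rw [Fcbar, Mesh.integralOn_eq_zero, sub_zero]
  intro K F hF n x hx
  rw [hV.2.2.1 F (hD ▸ hF) x hx, inner_zero_left, zero_mul]

theorem Fcbar_mid (hd : 0 < d) (hD : S.ΓD = S.mesh.exteriorFacets)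
    (hU : S.InSpace U) (hU' : S.InSpace U') (hW : S.InSpace W) (θ : ℝ) :
    S.Fcbar (Fields.mid θ U U') W.pbar = (1 - θ) * S.Fcbar U W.pbar + θ * S.Fcbar U' W.pbar := by
  have b : ∀ (c : ℝ) (V : Fields d), S.InSpace V →
      S.mesh.ContBoundaries (fun K F n x => c * (⟪S.uhat V K F n x, n⟫ * W.pbar F x)) := by
    intro c V hV K hK a ha
    have h1 := hV.continuous_uhat hK ha (outwardNormal K a)
    have h2 := hW.continuous_pbar hK ha
    fun_prop
  rw [(hU.mid hU' θ).Fcbar_eq hD, hU.Fcbar_eq hD, hU'.Fcbar_eq hD,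
    ← Mesh.sumBoundaries_const_mul, ← Mesh.sumBoundaries_const_mul,
      ← Mesh.sumBoundaries_add hd (b _ _ hU) (b _ _ hU')]
  refine Mesh.sumBoundaries_congr fun K _ a _ x => ?_
  rw [uhat_mid, inner_add_left, real_inner_smul_left, real_inner_smul_left]
  ring

/-- Integration by parts of the pressure against the velocity on all cells. -/
theorem InSpace.sumCells_gradient (hd : 0 < d) (hV : S.InSpace V) :
    S.mesh.sumCells (fun K x => ⟪V.u K x, gradient (V.p K) x⟫)
      + S.mesh.sumCells (fun K x => V.p K x * divergence (V.u K) x)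
      = S.mesh.sumBoundaries (fun K _ n x => V.p K x * ⟪V.u K x, n⟫) := by
  have hdivc : ∀ K ∈ S.mesh.cells, Continuous (divergence (V.u K)) := by
    intro K hK
    have := (hV.contDiff_u hK (n := 1)).continuous_fderiv (by simp)
    unfold divergence
    fun_prop
  rw [← Mesh.sumCells_add (fun K hK => continuous_inner_gradient hV hV hK)
    (g := fun K x => V.p K x * divergence (V.u K) x)
    (fun K hK => (hV.continuous_p hK).mul (hdivc K hK))]
  refine Finset.sum_congr rfl fun K hK => ?_
  have h1 := hV.contDiff_u hK (n := 1)
  have h2 := hV.contDiff_p hK (n := 1)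
  have hdiv := (S.mesh.isSimplex hK).integral_divergence hd (h2.smul h1)
  rw [setIntegral_openCell]
  simp only [Pi.smul_apply', real_inner_smul_left] at hdiv
  rw [← hdiv]
  refine integral_congr_ae (Filter.Eventually.of_forall fun x => ?_)
  have e1 := (h1.differentiable (by simp) x).hasFDerivAt
  have e2 := (h2.differentiable (by simp) x).hasFDerivAt
  have e3 : ⟪V.u K x, gradient (V.p K) x⟫ = fderiv ℝ (V.p K) x (V.u K x) := by
    rw [gradient, real_inner_comm, InnerProductSpace.toDual_symm_apply]
  have e4 : fderiv ℝ (V.p K) x (V.u K x)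
      = ∑ i, V.u K x i * fderiv ℝ (V.p K) x (EuclideanSpace.single i 1) := by
    conv_lhs => rw [← (EuclideanSpace.basisFun (Fin d) ℝ).sum_repr (V.u K x)]
    simp [map_sum]
  simp only [divergence]
  rw [(e2.smul e1).fderiv, e3, e4, Finset.mul_sum, ← Finset.sum_add_distrib]
  refine Finset.sum_congr rfl fun i _ => ?_
  simp
  ring

/-- For a field satisfying the continuity equations tested with its own pressures, the pressure
terms of the momentum equation reduce to the pressure stabilization, which is dissipative. -/
theorem InSpace.pressure_nonneg (hd : 0 < d) (hV : S.InSpace V)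
    (hD : S.ΓD = S.mesh.exteriorFacets) (hν : 0 ≤ S.ν) (hβ : 0 ≤ S.β)
    (hsize : ∀ K ∈ S.mesh.cells, ∀ a ∈ K, 0 ≤ S.facetSize (K.erase a))
    (hc : S.Fc V V.p = 0) (hcbar : S.Fcbar V V.pbar = 0) :
    0 ≤ -S.mesh.sumCells (fun K x => V.p K x * divergence (V.u K) x)
      + S.mesh.sumBoundaries (fun K F n x => V.pbar F x * ⟪V.u K x - V.ubar F x, n⟫) := by
  have hgrad := hV.sumCells_gradient hd
  rw [hV.Fcbar_eq hD] at hcbar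
  rw [Fc] at hc
  have hzero : S.mesh.sumBoundaries (fun _ F n x => ⟪V.pbar F x • V.ubar F x, n⟫) = 0 :=
    Mesh.sumBoundaries_inner_eq_zero hd _ fun F hF x hx => by
      rw [hV.2.2.1 F (hD ▸ hF) x hx, smul_zero]
  have cu : ∀ K ∈ S.mesh.cells, Continuous (V.u K) := fun K hK => hV.continuous_u hK
  have cp : ∀ K ∈ S.mesh.cells, Continuous (V.p K) := fun K hK => hV.continuous_p hK
  have cpb : ∀ K ∈ S.mesh.cells, ∀ a ∈ K, Continuous (V.pbar (K.erase a)) :=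
    fun K hK a ha => hV.continuous_pbar hK ha
  have cub : ∀ K ∈ S.mesh.cells, ∀ a ∈ K, Continuous (V.ubar (K.erase a)) :=
    fun K hK a ha => hV.continuous_ubar hK ha
  have cuh : ∀ K ∈ S.mesh.cells, ∀ a ∈ K,
      Continuous (S.uhat V K (K.erase a) (outwardNormal K a)) :=
    fun K hK a ha => hV.continuous_uhat hK ha _
  have b1 : S.mesh.ContBoundaries (fun K F n x => V.pbar F x * ⟪V.u K x - V.ubar F x, n⟫) := by
    intro K hK a ha
    have := cu K hK; have := cpb K hK a ha; have := cub K hK a ha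
    fun_prop
  have b2 : S.mesh.ContBoundaries (fun K F n x => ⟪V.pbar F x • V.ubar F x, n⟫) := by
    intro K hK a ha
    have := cpb K hK a ha; have := cub K hK a ha
    fun_prop
  have b3 : S.mesh.ContBoundaries (fun K F n x => ⟪S.uhat V K F n x, n⟫ * V.p K x) := by
    intro K hK a ha
    have := cp K hK; have := cuh K hK a ha
    fun_prop
  have b4 : S.mesh.ContBoundaries (fun K F n x => (-1) * (V.p K x * ⟪V.u K x, n⟫)) := by
    intro K hK a ha
    have := cp K hK; have := cu K hK
    fun_prop
  have b5 : S.mesh.ContBoundaries (fun K F n x => (-1) * (⟪S.uhat V K F n x, n⟫ * V.pbar F x)) := by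
    intro K hK a ha
    have := cpb K hK a ha; have := cuh K hK a ha
    fun_prop
  have b12 : S.mesh.ContBoundaries (fun K F n x => V.pbar F x * ⟪V.u K x - V.ubar F x, n⟫
      + ⟪V.pbar F x • V.ubar F x, n⟫) := fun K hK a ha => (b1 K hK a ha).add (b2 K hK a ha)
  have b34 : S.mesh.ContBoundaries (fun K F n x => ⟪S.uhat V K F n x, n⟫ * V.p K x
      + (-1) * (V.p K x * ⟪V.u K x, n⟫)) := fun K hK a ha => (b3 K hK a ha).add (b4 K hK a ha)
  have b345 : S.mesh.ContBoundaries (fun K F n x => (⟪S.uhat V K F n x, n⟫ * V.p K x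
      + (-1) * (V.p K x * ⟪V.u K x, n⟫)) + (-1) * (⟪S.uhat V K F n x, n⟫ * V.pbar F x)) :=
    fun K hK a ha => (b34 K hK a ha).add (b5 K hK a ha)
  have hstab : 0 ≤ S.mesh.sumBoundaries (fun K F n x =>
      (V.pbar F x * ⟪V.u K x - V.ubar F x, n⟫ + ⟪V.pbar F x • V.ubar F x, n⟫)
      + ((⟪S.uhat V K F n x, n⟫ * V.p K x + (-1) * (V.p K x * ⟪V.u K x, n⟫))
        + (-1) * (⟪S.uhat V K F n x, n⟫ * V.pbar F x))) := by
    refine Mesh.sumBoundaries_nonneg fun K hK a ha x => ?_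
    rw [S.inner_uhat_outwardNormal hd V hK ha, real_inner_smul_left, inner_sub_left]
    have hκ : 0 ≤ S.β * S.facetSize (K.erase a) / (S.ν + 1) :=
      div_nonneg (mul_nonneg hβ (hsize K hK a ha)) (by linarith)
    have := mul_nonneg hκ (sq_nonneg (V.pbar (K.erase a) x - V.p K x))
    nlinarith
  rw [Mesh.sumBoundaries_add hd b12 b345, Mesh.sumBoundaries_add hd b1 b2,
    Mesh.sumBoundaries_add hd b34 b5, Mesh.sumBoundaries_add hd b3 b4,
    Mesh.sumBoundaries_const_mul, Mesh.sumBoundaries_const_mul, hzero, hcbar] at hstab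
  linarith

end Scheme

/-! ### Coercivity of the viscous terms -/

section Tensor

variable {d k : ℕ}

theorem symGrad_apply_single (v : Pt d → Pt d) (x : Pt d) (i j : Fin d) :
    symGrad v x (EuclideanSpace.single j 1) i
      = 1 / 2 * (fderiv ℝ v x (EuclideanSpace.single j 1) i
        + fderiv ℝ v x (EuclideanSpace.single i 1) j) := by
  have h : ContinuousLinearMap.adjoint (fderiv ℝ v x) (EuclideanSpace.single j 1) i
      = fderiv ℝ v x (EuclideanSpace.single i 1) j := by
    have := ContinuousLinearMap.adjoint_inner_right (fderiv ℝ v x) (EuclideanSpace.single i 1)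
      (EuclideanSpace.single j 1)
    simpa [EuclideanSpace.inner_single_left, EuclideanSpace.inner_single_right] using this
  rw [← h]
  simp [symGrad]
  ring

theorem contract_id_fderiv (v : Pt d → Pt d) (x : Pt d) :
    contract (ContinuousLinearMap.id ℝ (Pt d)) (fderiv ℝ v x) = divergence v x := by
  simp only [contract, divergence, ContinuousLinearMap.id_apply, PiLp.single_apply, ite_mul,
    one_mul, zero_mul, Finset.sum_ite_eq, Finset.mem_univ, if_true]

theorem contract_symGrad_fderiv (v : Pt d → Pt d) (x : Pt d) :
    contract (symGrad v x) (fderiv ℝ v x) = contract (symGrad v x) (symGrad v x) := by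
  simp only [contract, symGrad_apply_single]
  set D : Fin d → Fin d → ℝ := fun i j => fderiv ℝ v x (EuclideanSpace.single j 1) i with hD
  have h1 : ∑ i, ∑ j, 1 / 2 * (D i j + D j i) * D i j
      = ∑ i, ∑ j, (1 / 2 * (D i j + D j i) * (1 / 2 * (D i j + D j i))
        + (1 / 4 * (D i j ^ 2) - 1 / 4 * (D j i ^ 2))) :=
    Finset.sum_congr rfl fun i _ => Finset.sum_congr rfl fun j _ => by ring
  have h2 : ∑ i, ∑ j, 1 / 4 * (D i j ^ 2) = ∑ i, ∑ j, 1 / 4 * (D j i ^ 2) := Finset.sum_comm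
  rw [h1]
  simp only [Finset.sum_add_distrib, Finset.sum_sub_distrib, h2, sub_self, add_zero]
  rfl

theorem contract_rankOne (a b : Pt d) (A : Pt d →L[ℝ] Pt d) :
    contract (InnerProductSpace.rankOne ℝ a b) A = ⟪A b, a⟫ := by
  have hb : A b = ∑ j, b j • A (EuclideanSpace.single j 1) := by
    conv_lhs => rw [← (EuclideanSpace.basisFun (Fin d) ℝ).sum_repr b]
    simp
  rw [PiLp.inner_apply, contract]
  refine Finset.sum_congr rfl fun i _ => ?_
  rw [hb]
  simp [InnerProductSpace.rankOne_apply, EuclideanSpace.inner_single_right, Finset.mul_sum]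
  exact Finset.sum_congr rfl fun j _ => by ring

theorem contract_sub_smul (c e : ℝ) (A B D : Pt d →L[ℝ] Pt d) :
    contract (c • A - e • B) D = c * contract A D - e * contract B D := by
  simp only [contract, Finset.mul_sum, ← Finset.sum_sub_distrib]
  refine Finset.sum_congr rfl fun i _ => Finset.sum_congr rfl fun j _ => ?_
  simp
  ring

theorem norm_apply_sq_le_contract (A : Pt d →L[ℝ] Pt d) {n : Pt d} (hn : ‖n‖ = 1) :
    ‖A n‖ ^ 2 ≤ contract A A := by
  have hb : A n = ∑ j, n j • A (EuclideanSpace.single j 1) := by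
    conv_lhs => rw [← (EuclideanSpace.basisFun (Fin d) ℝ).sum_repr n]
    simp
  rw [EuclideanSpace.norm_sq_eq, contract]
  refine Finset.sum_le_sum fun i _ => ?_
  have h1 : A n i = ∑ j, n j * A (EuclideanSpace.single j 1) i := by
    rw [hb]; simp
  have h2 : ∑ j, n j ^ 2 = 1 := by
    have := EuclideanSpace.norm_sq_eq n
    rw [hn] at this
    simpa using this.symm
  have := Finset.sum_mul_sq_le_sq_mul_sq Finset.univ (fun j => n j)
    (fun j => A (EuclideanSpace.single j 1) i)
  rw [h2, one_mul] at this
  rw [Real.norm_eq_abs, sq_abs, h1]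
  simpa only [sq] using this

theorem continuous_symGrad {v : Pt d → Pt d} (hv : ContDiff ℝ 1 v) : Continuous (symGrad v) := by
  have h1 : Continuous (fderiv ℝ v) := hv.continuous_fderiv (by simp)
  have h2 : Continuous (fun x => ContinuousLinearMap.adjoint (fderiv ℝ v x)) :=
    (LinearIsometryEquiv.continuous _).comp h1
  exact (h1.add h2).const_smul (1 / 2 : ℝ)

theorem IsVecPoly.contDiff {v : Pt d → Pt d} (hv : IsVecPoly k v) {n : WithTop ℕ∞} :
    ContDiff ℝ n v :=
  (contDiff_piLp 2).2 fun i => (hv i).contDiff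

theorem IsVecPoly.symGrad_apply_single {v : Pt d → Pt d} (hv : IsVecPoly k v) (i j : Fin d) :
    IsPoly k (fun x => symGrad v x (EuclideanSpace.single j 1) i) := by
  have h : ∀ i j : Fin d, IsPoly k (fun x => fderiv ℝ v x (EuclideanSpace.single j 1) i) := by
    intro i j
    have : (fun x => fderiv ℝ v x (EuclideanSpace.single j 1) i)
        = fun x => fderiv ℝ (fun y => v y i) x (EuclideanSpace.single j 1) := by
      ext x
      have h1 := (hv.contDiff (n := 1)).differentiable (by simp) x
      have h2 : HasFDerivAt (fun y => v y i)
          ((EuclideanSpace.proj i : Pt d →L[ℝ] ℝ).comp (fderiv ℝ v x)) x :=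
        (EuclideanSpace.proj i : Pt d →L[ℝ] ℝ).hasFDerivAt.comp x h1.hasFDerivAt
      rw [h2.fderiv]
      rfl
    rw [this]
    exact (hv i).fderiv_apply _
  simp only [HybridNS.symGrad_apply_single]
  exact ((h i j).add (h j i)).const_mul _

theorem contract_self (A : Pt d →L[ℝ] Pt d) :
    contract A A = ∑ i, ∑ j, A (EuclideanSpace.single j 1) i ^ 2 := by
  simp only [contract, sq]

end Tensor

namespace Scheme

variable {d : ℕ} {S : Scheme d} {V : Fields d}

theorem InSpace.continuous_symGrad (hV : S.InSpace V) {K : Finset (Pt d)}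
    (hK : K ∈ S.mesh.cells) : Continuous (symGrad (V.u K)) :=
  HybridNS.continuous_symGrad (hV.contDiff_u hK)

/-- The trace inequality for the symmetric gradient. -/
theorem InSpace.sum_facetSize_mul_integral_symGrad_le (hd : 0 < d) (hV : S.InSpace V) {C : ℝ}
    (hC : ∀ K ∈ S.mesh.cells, ∀ g : Pt d → ℝ, IsPoly S.k g →
      ∑ a ∈ K, S.facetSize (K.erase a) * ∫ x, g x ^ 2 ∂(facetMeasure (K.erase a))
        ≤ C * ∫ x in closedSimplex K, g x ^ 2)
    (hsize : ∀ K ∈ S.mesh.cells, ∀ a ∈ K, 0 < S.facetSize (K.erase a)) :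
    S.mesh.sumBoundaries (fun K F n x => S.facetSize F * ‖symGrad (V.u K) x n‖ ^ 2)
      ≤ C * S.mesh.sumCells (fun K x => contract (symGrad (V.u K) x) (symGrad (V.u K) x)) := by
  rw [Mesh.sumBoundaries, Mesh.sumCells, Finset.mul_sum]
  refine Finset.sum_le_sum fun K hK => ?_
  have sK := S.mesh.isSimplex hK
  have hp := fun i j => (hV.1 K hK).symGrad_apply_single i j
  have hpc := fun i j => (hp i j).continuous
  have hsc := hV.continuous_symGrad hK
  have hcell : ∫ x in openCell K, contract (symGrad (V.u K) x) (symGrad (V.u K) x)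
      = ∑ i, ∑ j,
        ∫ x in closedSimplex K, (symGrad (V.u K) x (EuclideanSpace.single j 1) i) ^ 2 := by
    rw [setIntegral_openCell]
    simp only [contract_self]
    rw [integral_finsetSum]
    · refine Finset.sum_congr rfl fun i _ => ?_
      rw [integral_finsetSum]
      exact fun j _ => integrableOn_closedSimplex K ((hpc i j).pow 2)
    · exact fun i _ => integrableOn_closedSimplex K
        (continuous_finsetSum _ fun j _ => (hpc i j).pow 2)
  have hfacet : ∀ a ∈ K, ∫ x, S.facetSize (K.erase a)
        * ‖symGrad (V.u K) x (outwardNormal K a)‖ ^ 2 ∂(facetMeasure (K.erase a))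
      ≤ ∑ i, ∑ j, S.facetSize (K.erase a) *
        ∫ x, (symGrad (V.u K) x (EuclideanSpace.single j 1) i) ^ 2 ∂(facetMeasure (K.erase a)) := by
    intro a ha
    rw [integral_const_mul]
    simp only [← Finset.mul_sum]
    refine mul_le_mul_of_nonneg_left ?_ (hsize K hK a ha).le
    have hint := fun i j => sK.integrable_facetMeasure hd ha ((hpc i j).pow 2)
    have hsum : ∑ i, ∑ j,
        ∫ x, (symGrad (V.u K) x (EuclideanSpace.single j 1) i) ^ 2 ∂(facetMeasure (K.erase a))
        = ∫ x, contract (symGrad (V.u K) x) (symGrad (V.u K) x) ∂(facetMeasure (K.erase a)) := by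
      simp only [contract_self]
      rw [integral_finsetSum]
      · refine Finset.sum_congr rfl fun i _ => ?_
        rw [integral_finsetSum]
        exact fun j _ => hint i j
      · exact fun i _ => integrable_finsetSum _ fun j _ => hint i j
    rw [hsum]
    refine integral_mono (sK.integrable_facetMeasure hd ha (by fun_prop))
      (sK.integrable_facetMeasure hd ha ?_)
      fun x => norm_apply_sq_le_contract _ (sK.norm_outwardNormal hd ha)
    simp only [contract_self]
    exact continuous_finsetSum _ fun i _ => continuous_finsetSum _ fun j _ => (hpc i j).pow 2
  refine (Finset.sum_le_sum hfacet).trans ?_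
  rw [hcell, Finset.mul_sum, Finset.sum_comm]
  refine Finset.sum_le_sum fun i _ => ?_
  rw [Finset.mul_sum, Finset.sum_comm]
  exact Finset.sum_le_sum fun j _ => hC K hK _ (hp i j)

/-- The viscous terms are nonnegative once the penalty parameter dominates the constant of the
trace inequality. -/
theorem InSpace.viscous_nonneg (hd : 0 < d) (hV : S.InSpace V) {C : ℝ}
    (hC : ∀ K ∈ S.mesh.cells, ∀ g : Pt d → ℝ, IsPoly S.k g →
      ∑ a ∈ K, S.facetSize (K.erase a) * ∫ x, g x ^ 2 ∂(facetMeasure (K.erase a))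
        ≤ C * ∫ x in closedSimplex K, g x ^ 2)
    (hsize : ∀ K ∈ S.mesh.cells, ∀ a ∈ K, 0 < S.facetSize (K.erase a))
    (hν : 0 ≤ S.ν) (hα : 0 < S.α) (hCα : C ≤ S.α) :
    0 ≤ 2 * S.ν * S.mesh.sumCells (fun K x => contract (symGrad (V.u K) x) (symGrad (V.u K) x))
      + S.mesh.sumBoundaries (fun K F n x =>
        4 * S.ν * ⟪V.ubar F x - V.u K x, symGrad (V.u K) x n⟫
          + S.α / S.facetSize F * (2 * S.ν) * ‖V.ubar F x - V.u K x‖ ^ 2) := by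
  have htr := hV.sum_facetSize_mul_integral_symGrad_le hd hC hsize
  set D := S.mesh.sumCells (fun K x => contract (symGrad (V.u K) x) (symGrad (V.u K) x)) with hD
  have hD0 : 0 ≤ D := Finset.sum_nonneg fun K _ => integral_nonneg fun x => by
    simp only [contract_self]
    exact Finset.sum_nonneg fun i _ => Finset.sum_nonneg fun j _ => sq_nonneg _
  have hmono : S.mesh.sumBoundaries (fun K F n x =>
      -(2 * S.ν / S.α) * (S.facetSize F * ‖symGrad (V.u K) x n‖ ^ 2))
      ≤ S.mesh.sumBoundaries (fun K F n x =>
        4 * S.ν * ⟪V.ubar F x - V.u K x, symGrad (V.u K) x n⟫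
          + S.α / S.facetSize F * (2 * S.ν) * ‖V.ubar F x - V.u K x‖ ^ 2) := by
    refine Mesh.sumBoundaries_mono hd (fun K hK a ha => ?_) (fun K hK a ha => ?_)
      fun K hK a ha x => ?_
    · have := hV.continuous_symGrad hK
      fun_prop
    · have := hV.continuous_symGrad hK
      have := hV.continuous_u hK
      have := hV.continuous_ubar hK ha
      fun_prop
    · set X := V.ubar (K.erase a) x - V.u K x
      set Y := symGrad (V.u K) x (outwardNormal K a)
      set h := S.facetSize (K.erase a)
      have hh0 : 0 < h := hsize K hK a ha
      -- Young's inequality with weight `α / h`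
      have hcs := abs_le.1 (abs_real_inner_le_norm X Y)
      have e1 : S.α / h * (2 * S.ν) * ‖X‖ ^ 2 - 4 * S.ν * (‖X‖ * ‖Y‖)
          + 2 * S.ν / S.α * (h * ‖Y‖ ^ 2)
          = 2 * S.ν * (S.α / h) * (‖X‖ - h / S.α * ‖Y‖) ^ 2 := by
        field_simp
        ring
      have e2 : 0 ≤ 2 * S.ν * (S.α / h) * (‖X‖ - h / S.α * ‖Y‖) ^ 2 := by positivity
      have e3 := mul_le_mul_of_nonneg_left hcs.1 (by positivity : 0 ≤ 4 * S.ν)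
      linarith
  rw [Mesh.sumBoundaries_const_mul] at hmono
  have h1 : 2 * S.ν / S.α * S.mesh.sumBoundaries
      (fun K F n x => S.facetSize F * ‖symGrad (V.u K) x n‖ ^ 2) ≤ 2 * S.ν * D := by
    calc _ ≤ 2 * S.ν / S.α * (S.α * D) := by
          refine mul_le_mul_of_nonneg_left (htr.trans ?_) (by positivity)
          exact mul_le_mul_of_nonneg_right hCα hD0
      _ = 2 * S.ν * D := by field_simp
  linarith

end Scheme

/-! ### Convection -/

namespace Scheme

variable {d : ℕ} {S : Scheme d} {U U' V : Fields d} {τ : Step d}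

/-- The upwinding switch leaves a continuous function of the normal velocity. -/
theorem lam_mul_inner (S : Scheme d) (U : Fields d) (K F : Finset (Pt d)) (n x : Pt d) :
    S.lam U K F n x * ⟪S.uhat U K F n x, n⟫ = min ⟪S.uhat U K F n x, n⟫ 0 := by
  rw [lam]
  split_ifs with h
  · rw [one_mul, min_eq_left h.le]
  · rw [zero_mul, min_eq_right (not_lt.1 h)]

/-- With `χ = 1/2`, the convective facet terms tested with `(u, -ū)` combine to
`½ |û · n| |ū - u|²`. -/
theorem InSpace.convection_nonneg (hd : 0 < d) (hU : S.InSpace U) (hV : S.InSpace V) :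
    0 ≤ 1 / 2 * S.mesh.sumBoundaries (fun K F n x =>
        ⟪S.uhat U K F n x, n⟫ * ⟪V.u K x, V.u K x⟫)
      + S.mesh.sumBoundaries (fun K F n x =>
        S.lam U K F n x * ⟪S.uhat U K F n x, n⟫ * ⟪V.ubar F x - V.u K x, V.u K x⟫)
      + 1 / 2 * S.mesh.sumBoundaries (fun K F n x =>
        ⟪S.uhat U K F n x, n⟫ * ⟪V.u K x, -V.ubar F x⟫)
      + -(1 / 2) * S.mesh.sumBoundaries (fun K F n x =>
        ⟪S.uhat U K F n x, n⟫ * ⟪V.ubar F x - V.u K x, -V.ubar F x⟫)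
      + S.mesh.sumBoundaries (fun K F n x =>
        S.lam U K F n x * ⟪S.uhat U K F n x, n⟫ * ⟪V.ubar F x - V.u K x, -V.ubar F x⟫) := by
  simp only [lam_mul_inner]
  have cont : ∀ (c : ℝ) (w : ℝ → ℝ) (A B : Finset (Pt d) → Finset (Pt d) → Pt d → Pt d),
      Continuous w →
      (∀ K ∈ S.mesh.cells, ∀ a ∈ K, Continuous (A K (K.erase a))) →
      (∀ K ∈ S.mesh.cells, ∀ a ∈ K, Continuous (B K (K.erase a))) →
      S.mesh.ContBoundaries (fun K F n x =>
        c * (w ⟪S.uhat U K F n x, n⟫ * ⟪A K F x, B K F x⟫)) := by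
    intro c w A B hw hA hB K hK a ha
    have h1 := hU.continuous_uhat hK ha (outwardNormal K a)
    have h2 := hA K hK a ha
    have h3 := hB K hK a ha
    fun_prop
  have cu : ∀ K ∈ S.mesh.cells, ∀ a ∈ K, Continuous (V.u K) := fun K hK _ _ => hV.continuous_u hK
  have cub : ∀ K ∈ S.mesh.cells, ∀ a ∈ K, Continuous (fun x => -V.ubar (K.erase a) x) :=
    fun K hK a ha => (hV.continuous_ubar hK ha).neg
  have cx : ∀ K ∈ S.mesh.cells, ∀ a ∈ K, Continuous (fun x => V.ubar (K.erase a) x - V.u K x) :=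
    fun K hK a ha => (hV.continuous_ubar hK ha).sub (hV.continuous_u hK)
  have hmin : Continuous (fun t : ℝ => min t 0) := continuous_id.min continuous_const
  have b1 := cont (1 / 2) (fun t => t) (fun K _ => V.u K) (fun K _ => V.u K) continuous_id cu cu
  have b2 := cont 1 (fun t => min t 0) (fun K F x => V.ubar F x - V.u K x) (fun K _ => V.u K)
    hmin cx cu
  have b3 := cont (1 / 2) (fun t => t) (fun K _ => V.u K) (fun _ F x => -V.ubar F x)
    continuous_id cu cub
  have b4 := cont (-(1 / 2)) (fun t => t) (fun K F x => V.ubar F x - V.u K x)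
    (fun _ F x => -V.ubar F x) continuous_id cx cub
  have b5 := cont 1 (fun t => min t 0) (fun K F x => V.ubar F x - V.u K x)
    (fun _ F x => -V.ubar F x) hmin cx cub
  simp only [one_mul] at b2 b5
  rw [← Mesh.sumBoundaries_const_mul, ← Mesh.sumBoundaries_const_mul,
    ← Mesh.sumBoundaries_const_mul, ← Mesh.sumBoundaries_add hd b1 b2,
    ← Mesh.sumBoundaries_add hd (fun K hK a ha => (b1 K hK a ha).add (b2 K hK a ha)) b3,
    ← Mesh.sumBoundaries_add hd
      (fun K hK a ha => ((b1 K hK a ha).add (b2 K hK a ha)).add (b3 K hK a ha)) b4,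
    ← Mesh.sumBoundaries_add hd
      (fun K hK a ha => (((b1 K hK a ha).add (b2 K hK a ha)).add (b3 K hK a ha)).add
        (b4 K hK a ha)) b5]
  refine Mesh.sumBoundaries_nonneg fun K hK a ha x => ?_
  set w := ⟪S.uhat U K (K.erase a) (outwardNormal K a) x, outwardNormal K a⟫
  set u := V.u K x
  set v := V.ubar (K.erase a) x
  have hw : 0 ≤ 1 / 2 * w - min w 0 := by
    rcases le_total w 0 with h | h
    · rw [min_eq_left h]; linarith
    · rw [min_eq_right h]; linarith
  have := mul_nonneg hw (real_inner_self_nonneg (x := v - u))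
  simp only [inner_sub_left, inner_sub_right, inner_neg_right, real_inner_comm u v] at this ⊢
  rw [real_inner_comm v u] at *
  nlinarith

/-! ### The energy balance -/

theorem glue_mid (M : Mesh d) (θ : ℝ) (U U' : Fields d) (x : Pt d) :
    M.glue (Fields.mid θ U U').u x = (1 - θ) • M.glue U.u x + θ • M.glue U'.u x := by
  simp only [Mesh.glue, Fields.mid, Finset.smul_sum, ← Finset.sum_add_distrib]
  refine Finset.sum_congr rfl fun K _ => ?_
  by_cases h : x ∈ openCell K <;> simp [h]

theorem InSpace.memLp_glue (hU : S.InSpace U) (s : Set (Pt d)) :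
    MemLp (S.mesh.glue U.u) 2 (volume.restrict s) := by
  have h : MemLp (S.mesh.glue U.u) 2 volume := by
    have : S.mesh.glue U.u = fun x => ∑ K ∈ S.mesh.cells, (openCell K).indicator (U.u K) x := rfl
    rw [this]
    refine memLp_finsetSum _ fun K hK => ?_
    have hm : MeasurableSet (openCell K) := isOpen_interior.measurableSet
    rw [memLp_indicator_iff_restrict hm]
    obtain ⟨B, hB⟩ := (isCompact_closedSimplex K).exists_bound_of_continuousOn
      (hU.continuous_u hK).continuousOn
    have : IsFiniteMeasure ((volume : Measure (Pt d)).restrict (openCell K)) :=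
      isFiniteMeasure_restrict.2 ((measure_mono interior_subset).trans_lt
        (isCompact_closedSimplex K).measure_lt_top).ne
    exact MemLp.of_bound (hU.continuous_u hK).aestronglyMeasurable B
      ((ae_restrict_mem hm).mono fun x hx => hB x (interior_subset hx))
  exact h.restrict s

/-- The discrete time derivative tested with `u_{n+θ}` controls the growth of the energy for
`θ ≥ 1/2`. -/
theorem InSpace.energy_le (hU : S.InSpace U) (hU' : S.InSpace U') {θ δt : ℝ} (hδt : 0 < δt)
    (hθ : 1 / 2 ≤ θ) (s : Set (Pt d)) :
    δt⁻¹ * (1 / 2 * ((∫ x in s, ‖S.mesh.glue U'.u x‖ ^ 2) - ∫ x in s, ‖S.mesh.glue U.u x‖ ^ 2))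
      ≤ ∫ x in s, ⟪δt⁻¹ • (S.mesh.glue U'.u x - S.mesh.glue U.u x),
          S.mesh.glue (Fields.mid θ U U').u x⟫ := by
  have m := hU.memLp_glue s
  have m' := hU'.memLp_glue s
  have i := m.integrable_norm_pow (by simp)
  have i' := m'.integrable_norm_pow (by simp)
  have i'' := (m'.sub m).integrable_norm_pow (by simp)
  simp only [Pi.sub_apply] at i i' i''
  have hpt : ∀ x, ⟪δt⁻¹ • (S.mesh.glue U'.u x - S.mesh.glue U.u x),
      S.mesh.glue (Fields.mid θ U U').u x⟫
      = δt⁻¹ * (1 / 2 * (‖S.mesh.glue U'.u x‖ ^ 2 - ‖S.mesh.glue U.u x‖ ^ 2)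
        + (θ - 1 / 2) * ‖S.mesh.glue U'.u x - S.mesh.glue U.u x‖ ^ 2) := by
    intro x
    rw [glue_mid, real_inner_smul_left]
    simp only [← real_inner_self_eq_norm_sq, inner_sub_left, inner_sub_right, inner_add_right,
      inner_smul_right]
    rw [real_inner_comm (S.mesh.glue U'.u x) (S.mesh.glue U.u x)]
    ring
  simp only [hpt]
  have e1 : Integrable (fun x => 1 / 2 * (‖S.mesh.glue U'.u x‖ ^ 2 - ‖S.mesh.glue U.u x‖ ^ 2))
      (volume.restrict s) := (i'.sub i).const_mul _
  rw [integral_const_mul, integral_add e1 (i''.const_mul _),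
    integral_const_mul, integral_const_mul, integral_sub i' i]
  refine mul_le_mul_of_nonneg_left ?_ (inv_pos.2 hδt).le
  have : 0 ≤ (θ - 1 / 2) * ∫ x in s, ‖S.mesh.glue U'.u x - S.mesh.glue U.u x‖ ^ 2 :=
    mul_nonneg (by linarith) (integral_nonneg fun x => sq_nonneg _)
  linarith

theorem sigmaDhat_outwardNormal (hd : 0 < d) (S : Scheme d) (V : Fields d) {K : Finset (Pt d)}
    (hK : K ∈ S.mesh.cells) {a : Pt d} (ha : a ∈ K) (F : Finset (Pt d)) (x : Pt d) :
    S.sigmaDhat V K F (outwardNormal K a) x (outwardNormal K a)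
      = V.pbar F x • outwardNormal K a
        - (2 * S.ν) • symGrad (V.u K) x (outwardNormal K a)
        - (S.α / S.facetSize F * (2 * S.ν)) • (V.ubar F x - V.u K x) := by
  simp [sigmaDhat, InnerProductSpace.rankOne_apply,
    (S.mesh.isSimplex hK).norm_outwardNormal hd ha]

/-- The diffusive terms of the momentum equation tested with `(u, -ū)` split into the viscous and
the pressure terms. -/
theorem InSpace.diffusive_eq (hd : 0 < d) (hV : S.InSpace V) :
    -S.mesh.sumCells (fun K x => contract (S.sigmaD V K x) (fderiv ℝ (V.u K) x))
      + S.mesh.sumBoundaries (fun K F n x => ⟪S.sigmaDhat V K F n x n, V.u K x⟫)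
      + S.mesh.sumBoundaries (fun K F n x =>
          2 * S.ν * ⟪V.ubar F x - V.u K x, symGrad (V.u K) x n⟫)
      + S.mesh.sumBoundaries (fun K F n x => ⟪S.sigmaDhat V K F n x n, -V.ubar F x⟫)
      = (2 * S.ν * S.mesh.sumCells (fun K x => contract (symGrad (V.u K) x) (symGrad (V.u K) x))
        + S.mesh.sumBoundaries (fun K F n x =>
          4 * S.ν * ⟪V.ubar F x - V.u K x, symGrad (V.u K) x n⟫
            + S.α / S.facetSize F * (2 * S.ν) * ‖V.ubar F x - V.u K x‖ ^ 2))
        + (-S.mesh.sumCells (fun K x => V.p K x * divergence (V.u K) x)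
        + S.mesh.sumBoundaries (fun K F n x => V.pbar F x * ⟪V.u K x - V.ubar F x, n⟫)) := by
  have csig : ∀ K ∈ S.mesh.cells, ∀ a ∈ K, Continuous (fun x =>
      S.sigmaDhat V K (K.erase a) (outwardNormal K a) x (outwardNormal K a)) := by
    intro K hK a ha
    simp only [sigmaDhat_outwardNormal hd S V hK ha]
    have := hV.continuous_symGrad hK
    have := hV.continuous_u hK
    have := hV.continuous_ubar hK ha
    have := hV.continuous_pbar hK ha
    fun_prop
  have b1 : S.mesh.ContBoundaries (fun K F n x => ⟪S.sigmaDhat V K F n x n, V.u K x⟫) :=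
    fun K hK a ha => (csig K hK a ha).inner (hV.continuous_u hK)
  have b2 : S.mesh.ContBoundaries (fun K F n x =>
      2 * S.ν * ⟪V.ubar F x - V.u K x, symGrad (V.u K) x n⟫) := by
    intro K hK a ha
    have := hV.continuous_symGrad hK
    have := hV.continuous_u hK
    have := hV.continuous_ubar hK ha
    fun_prop
  have b3 : S.mesh.ContBoundaries (fun K F n x => ⟪S.sigmaDhat V K F n x n, -V.ubar F x⟫) :=
    fun K hK a ha => (csig K hK a ha).inner (hV.continuous_ubar hK ha).neg
  have b4 : S.mesh.ContBoundaries (fun K F n x =>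
      4 * S.ν * ⟪V.ubar F x - V.u K x, symGrad (V.u K) x n⟫
        + S.α / S.facetSize F * (2 * S.ν) * ‖V.ubar F x - V.u K x‖ ^ 2) := by
    intro K hK a ha
    have := hV.continuous_symGrad hK
    have := hV.continuous_u hK
    have := hV.continuous_ubar hK ha
    fun_prop
  have b5 : S.mesh.ContBoundaries (fun K F n x => V.pbar F x * ⟪V.u K x - V.ubar F x, n⟫) := by
    intro K hK a ha
    have := hV.continuous_u hK
    have := hV.continuous_ubar hK ha
    have := hV.continuous_pbar hK ha
    fun_prop
  have hB : S.mesh.sumBoundaries (fun K F n x => ⟪S.sigmaDhat V K F n x n, V.u K x⟫)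
      + S.mesh.sumBoundaries (fun K F n x =>
          2 * S.ν * ⟪V.ubar F x - V.u K x, symGrad (V.u K) x n⟫)
      + S.mesh.sumBoundaries (fun K F n x => ⟪S.sigmaDhat V K F n x n, -V.ubar F x⟫)
      = S.mesh.sumBoundaries (fun K F n x =>
          4 * S.ν * ⟪V.ubar F x - V.u K x, symGrad (V.u K) x n⟫
            + S.α / S.facetSize F * (2 * S.ν) * ‖V.ubar F x - V.u K x‖ ^ 2)
        + S.mesh.sumBoundaries (fun K F n x => V.pbar F x * ⟪V.u K x - V.ubar F x, n⟫) := by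
    rw [← Mesh.sumBoundaries_add hd b1 b2,
      ← Mesh.sumBoundaries_add hd (fun K hK a ha => (b1 K hK a ha).add (b2 K hK a ha)) b3,
      ← Mesh.sumBoundaries_add hd b4 b5]
    refine Mesh.sumBoundaries_congr fun K hK a ha x => ?_
    rw [sigmaDhat_outwardNormal hd S V hK ha]
    set n := outwardNormal K a
    set Y := symGrad (V.u K) x n
    set u := V.u K x
    set v := V.ubar (K.erase a) x
    rw [← real_inner_self_eq_norm_sq]
    simp only [inner_sub_left, inner_sub_right, inner_neg_right, real_inner_smul_left]
    rw [real_inner_comm u n, real_inner_comm v n, real_inner_comm u Y, real_inner_comm v Y,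
      real_inner_comm u v]
    ring
  have hA : S.mesh.sumCells (fun K x => contract (S.sigmaD V K x) (fderiv ℝ (V.u K) x))
      = S.mesh.sumCells (fun K x => V.p K x * divergence (V.u K) x)
        + -(2 * S.ν) * S.mesh.sumCells (fun K x =>
          contract (symGrad (V.u K) x) (symGrad (V.u K) x)) := by
    have cdiv : S.mesh.ContCells (fun K x => V.p K x * divergence (V.u K) x) := by
      intro K hK
      have h1 := (hV.contDiff_u hK (n := 1)).continuous_fderiv (by simp)
      have h2 := hV.continuous_p hK
      unfold divergence
      fun_prop
    have csym : S.mesh.ContCells (fun K x =>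
        -(2 * S.ν) * contract (symGrad (V.u K) x) (symGrad (V.u K) x)) := by
      intro K hK
      have h1 := hV.continuous_symGrad hK
      unfold contract
      fun_prop
    rw [← Mesh.sumCells_const_mul, ← Mesh.sumCells_add cdiv csym]
    refine Mesh.sumCells_congr fun K _ x => ?_
    rw [sigmaD, contract_sub_smul, contract_id_fderiv, contract_symGrad_fderiv]
    ring
  rw [hA]
  linarith

/-- The momentum functionals tested with `(u_{n+θ}, -ū_{n+θ})`: the convective volume terms cancel
for `χ = 1/2`. -/
theorem Fm_add_Fmbar_eq (hχ : S.χ = 1 / 2) (hD : S.ΓD = S.mesh.exteriorFacets)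
    (hf : τ.f =ᵐ[volume.restrict S.mesh.domain] 0) (hV : Fields.mid τ.θ U U' = V) :
    S.Fm τ U U' V.u + S.Fmbar τ U U' (fun F x => -V.ubar F x)
      = (∫ x in S.mesh.domain,
          ⟪τ.δt⁻¹ • (S.mesh.glue U'.u x - S.mesh.glue U.u x), S.mesh.glue V.u x⟫)
        + (1 / 2 * S.mesh.sumBoundaries (fun K F n x =>
            ⟪S.uhat U K F n x, n⟫ * ⟪V.u K x, V.u K x⟫)
          + S.mesh.sumBoundaries (fun K F n x =>
            S.lam U K F n x * ⟪S.uhat U K F n x, n⟫ * ⟪V.ubar F x - V.u K x, V.u K x⟫)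
          + 1 / 2 * S.mesh.sumBoundaries (fun K F n x =>
            ⟪S.uhat U K F n x, n⟫ * ⟪V.u K x, -V.ubar F x⟫)
          + -(1 / 2) * S.mesh.sumBoundaries (fun K F n x =>
            ⟪S.uhat U K F n x, n⟫ * ⟪V.ubar F x - V.u K x, -V.ubar F x⟫)
          + S.mesh.sumBoundaries (fun K F n x =>
            S.lam U K F n x * ⟪S.uhat U K F n x, n⟫ * ⟪V.ubar F x - V.u K x, -V.ubar F x⟫))
        + (-S.mesh.sumCells (fun K x => contract (S.sigmaD V K x) (fderiv ℝ (V.u K) x))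
          + S.mesh.sumBoundaries (fun K F n x => ⟪S.sigmaDhat V K F n x n, V.u K x⟫)
          + S.mesh.sumBoundaries (fun K F n x =>
              2 * S.ν * ⟪V.ubar F x - V.u K x, symGrad (V.u K) x n⟫)
          + S.mesh.sumBoundaries (fun K F n x => ⟪S.sigmaDhat V K F n x n, -V.ubar F x⟫)) := by
  have hΓ : ∀ g, S.mesh.integralOn S.ΓN g = 0 := fun g =>
    Mesh.integralOn_eq_zero fun K F hF => by simp [ΓN, hD] at hF
  have hf0 : ∫ x in S.mesh.domain, ⟪τ.f x, S.mesh.glue V.u x⟫ = 0 := by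
    refine integral_eq_zero_of_ae ?_
    filter_upwards [hf] with x hx
    rw [hx]; simp
  have hconv : S.mesh.sumCells (fun K x =>
      contract (InnerProductSpace.rankOne ℝ (V.u K x) (U.u K x)) (fderiv ℝ (V.u K) x))
      = S.mesh.sumCells (fun K x => ⟪fderiv ℝ (V.u K) x (U.u K x), V.u K x⟫) :=
    Mesh.sumCells_congr fun K _ x => contract_rankOne _ _ _
  simp only [Fm, Fmbar, hV, hχ, hΓ, hf0, hconv]
  ring

end Scheme

end HybridNS

open HybridNS in
theorem mainTheorem5 (d : ℕ) (hd1 : 1 ≤ d) (hd3 : d ≤ 3) (k : ℕ) (hk : 1 ≤ k)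
    (σ : ℝ) (hσ : 0 < σ) :
    ∃ α₀ : ℝ, 0 < α₀ ∧
      ∀ S : Scheme d, S.k = k → S.mesh.Regular S.cellSize σ →
        S.χ = 1 / 2 → S.ΓD = S.mesh.exteriorFacets →
        0 ≤ S.ν → 0 ≤ S.β → α₀ ≤ S.α →
        ∀ (τ τ' : Step d) (Uprev U U' : Fields d),
          -- `U = U_n` solves the problem at time `t_n`, `U' = U_{n+1}` the one at time `t_{n+1}`
          S.Solves τ Uprev U → S.Solves τ' U U' →
          τ'.f =ᵐ[MeasureTheory.volume.restrict S.mesh.domain] 0 → 1 / 2 ≤ τ'.θ →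
          ∫ x in S.mesh.domain, ‖S.mesh.glue U'.u x‖ ^ 2
            ≤ ∫ x in S.mesh.domain, ‖S.mesh.glue U.u x‖ ^ 2 := by
  have hd : 0 < d := hd1
  obtain ⟨C, hC, htrace⟩ := exists_weighted_trace_inequality hd k hσ
  refine ⟨C + 1, by positivity, ?_⟩
  intro S hSk hreg hχ hD hν hβ hα τ τ' Uprev U U' hsol hsol' hf hθ
  have hU : S.InSpace U := hsol.2.2.1
  have hU' : S.InSpace U' := hsol'.2.2.1
  have hδt : 0 < τ'.δt := hsol'.1.2.2.1
  obtain ⟨V, hVdef⟩ : ∃ V, Fields.mid τ'.θ U U' = V := ⟨_, rfl⟩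
  have hV : S.InSpace V := hVdef ▸ hU.mid hU' τ'.θ
  have hsize : ∀ K ∈ S.mesh.cells, ∀ a ∈ K, 0 < S.facetSize (K.erase a) :=
    fun K hK a _ => S.facetSize_pos hd hσ hreg hK
  -- the continuity equations hold at both time levels, hence for `u_{n+θ}`
  have hc : S.Fc V V.p = 0 := by
    have := Scheme.Fc_mid hd hU hU' hV τ'.θ
    rwa [(hsol.continuity hV).1, (hsol'.continuity hV).1, mul_zero, mul_zero, add_zero,
      hVdef] at this
  have hcbar : S.Fcbar V V.pbar = 0 := by
    have := Scheme.Fcbar_mid hd hD hU hU' hV τ'.θ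
    rwa [(hsol.continuity hV).2, (hsol'.continuity hV).2, mul_zero, mul_zero, add_zero,
      hVdef] at this
  have hpress := hV.pressure_nonneg hd hD hν hβ (fun K hK a ha => (hsize K hK a ha).le) hc hcbar
  have hvisc := hV.viscous_nonneg hd
    (fun K hK g hg => htrace S hreg K hK g (hSk ▸ hg)) hsize hν (by linarith) (by linarith)
  have hconv := hU.convection_nonneg hd hV
  have henergy := hU.energy_le hU' hδt hθ S.mesh.domain
  have hmom := hsol'.momentum hV
  rw [Scheme.Fm_add_Fmbar_eq hχ hD hf hVdef, hV.diffusive_eq hd] at hmom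
  rw [hVdef] at henergy
  have hle : τ'.δt⁻¹ * (1 / 2 * ((∫ x in S.mesh.domain, ‖S.mesh.glue U'.u x‖ ^ 2)
      - ∫ x in S.mesh.domain, ‖S.mesh.glue U.u x‖ ^ 2)) ≤ 0 := by linarith
  have := nonpos_of_mul_nonpos_right hle (inv_pos.2 hδt)
  linarith
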